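/- Let $m\ge 2$ be an integer and $\Sigma=\{\alpha_1,\dots,\alpha_m,\beta_1,\dots,\beta_m\}$. Let $M$ be the Dyck monoid: the monoid with zero generated by $\Sigma$ subject to $\alpha_j\beta_j=1$ for all $j$ and $\alpha_i\beta_j=0$ for $i\neq j$. The Dyck shift $X\subset\Sigma^{\mathbb Z}$ is the set of all $x$ such that every finite block $x_r x_{r+1}\cdots x_l$ is nonzero in $M$, with the left shift $T$, $(Tx)_n=x_{n+1}$. For $z\in\{0,1\}^{\mathbb Z}$ let $\tilde H_0(z)=0$ and $\tilde H_{i+1}(z)-\tilde H_i(z)=1$ if $z_i=1$ and $-1$ if $z_i=0$, for all $i\in\mathbb Z$. Let $S$ be the set of all $z$ with $\liminf_{i\to+\infty}\tilde H_i(z)=\liminf_{i\to-\infty}\tilde H_i(z)=-\infty$. Put $\gamma_k(z)=\sum_{i=0}^{k}z_i$ for $k\ge 0$, $\gamma_k(z)=-\sum_{i=k}^{-1}z_i$ for $k<0$, and, for $z\in S$, $\varepsilon_n(z)=\max\{l<n:\tilde H_l(z)\le\tilde H_{n+1}(z)\}$. Define $F:S\times\{1,\dots,m\}^{\mathbb Z}\to\Sigma^{\mathbb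 Z}$ by $F(z,a)_n=\alpha_j$ with $j=a_{\gamma_n(z)}$ if $z_n=1$, and $F(z,a)_n=\beta_j$ with $j=a_{\gamma_k(z)}$, $k=\varepsilon_n(z)$, if $z_n=0$. Let $\mu_1,\mu_2$ be the symmetric (uniform) product measures on $\{0,1\}^{\mathbb Z}$ and $\{1,\dots,m\}^{\mathbb Z}$, and let $\tilde\mu=(\mu_1\times\mu_2)\circ F^{-1}$, regarded as a Borel measure on $X$. A Borel measure $\mu$ on $X$ is double-tail invariant if $\mu(A)=\mu(g(A))$ for every Borel set $A\subset X$ and every injective Borel map $g:A\to X$ such that, for every $x\in A$, $x$ and $g(x)$ differ in only finitely many coordinates. A measure of maximal entropy is a $T$-invariant Borel probability whose Kolmogorov–Sinai entropy equals the topological entropy $h_{\mathrm{top}}(X,T)$. Then $\tilde\mu$ is a probability measure on $X$ that is both $T$-invariant and double-tail invariant, and its Kolmogorov–Sinai entropy (with natural logarithms) is $$h_{\tilde\mu}(X,T)=\log 2+\tfrac12\log m .$$ Moreover $h_{\tilde\mu}(X,T)<h_{\mathrm{top}}(X,T)$; in particular $\tilde\mu$ is not a measure of maximal entropy. -/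

import Mathlib

open MeasureTheory Filter

/-! ### Entropy of a measure and double-tail invariance -/

section General

variable {Ω : Type*} [MeasurableSpace Ω]

/-- Shannon entropy (natural logarithm) of the partition of `Ω` into the fibres of `P`. -/
noncomputable def partitionEntropy {ι : Type*} [Fintype ι] (μ : Measure Ω) (P : Ω → ι) : ℝ :=
  ∑ i, Real.negMulLog (μ.real (P ⁻¹' {i}))

/-- The join of the partitions `P, T⁻¹ P, …, T⁻⁽ⁿ⁻¹⁾ P`, labelled by itineraries of length `n`. -/
def itinerary {ι : Type*} (T : Ω → Ω) (P : Ω → ι) (n : ℕ) (x : Ω) : Fin n → ι :=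
  fun j => P (T^[j] x)

/-- Entropy of `T` relative to the finite partition `P`: the (upper) limit of
`H_μ(P ∨ T⁻¹ P ∨ … ∨ T⁻⁽ⁿ⁻¹⁾ P) / n`. -/
noncomputable def entropyOfPartition {ι : Type*} [Fintype ι] (μ : Measure Ω) (T : Ω → Ω)
    (P : Ω → ι) : EReal :=
  limsup (fun n : ℕ => ((partitionEntropy μ (itinerary T P n) / n : ℝ) : EReal)) atTop

/-- Kolmogorov–Sinai entropy: the supremum over all finite measurable partitions, a partition into
at most `k` pieces being given by a measurable map to `Fin k`. -/
noncomputable def ksEntropy (μ : Measure Ω) (T : Ω → Ω) : EReal :=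
  ⨆ (k : ℕ) (P : Ω → Fin k) (_ : Measurable P), entropyOfPartition μ T P

/-- A measure of maximal entropy: an invariant probability whose entropy equals the topological
entropy. -/
def IsMaximalEntropyMeasure [UniformSpace Ω] (μ : Measure Ω) (T : Ω → Ω) : Prop :=
  IsProbabilityMeasure μ ∧ MeasurePreserving T μ μ ∧
    ksEntropy μ T = Dynamics.coverEntropy T Set.univ

/-- The double-tail (homoclinic) relation of a subset `X` of a full two-sided shift. -/
def DoubleTail {A : Type*} {X : Set (ℤ → A)} (x y : X) : Prop :=
  ∃ n : ℕ, ∀ k : ℤ, (n : ℤ) < |k| → x.1 k = y.1 k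

/-- `g`, regarded as a map on `S`, is a holonomy of the double-tail relation. -/
structure IsHolonomy {A : Type*} [MeasurableSpace A] {X : Set (ℤ → A)} (S : Set X) (g : S → X) :
    Prop where
  measurableSet_domain : MeasurableSet S
  measurable : Measurable g
  injective : Function.Injective g
  doubleTail : ∀ x : S, DoubleTail x.1 (g x)

def DoubleTailInvariant {A : Type*} [MeasurableSpace A] {X : Set (ℤ → A)} (μ : Measure X) : Prop :=
  ∀ (S : Set X) (g : S → X), IsHolonomy S g → μ S = μ (Set.range g)

end General

/-! ### The Dyck shift -/

/-- The alphabet `α₁, …, αₘ, β₁, …, βₘ`. -/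
inductive DyckLetter (m : ℕ) : Type
  | α (j : Fin m)
  | β (j : Fin m)

instance (m : ℕ) : MeasurableSpace (DyckLetter m) := ⊤

/-- The discrete uniform structure. -/
instance (m : ℕ) : UniformSpace (DyckLetter m) := ⊥

/-- The defining relations of the Dyck monoid, on the free monoid with a zero adjoined. -/
inductive DyckRel (m : ℕ) :
    WithZero (FreeMonoid (DyckLetter m)) → WithZero (FreeMonoid (DyckLetter m)) → Prop
  | cancel (j : Fin m) : DyckRel m
      ((FreeMonoid.of (DyckLetter.α j) * FreeMonoid.of (DyckLetter.β j) :
        FreeMonoid (DyckLetter m)) : WithZero (FreeMonoid (DyckLetter m))) 1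
  | mismatch (i j : Fin m) (h : i ≠ j) : DyckRel m
      ((FreeMonoid.of (DyckLetter.α i) * FreeMonoid.of (DyckLetter.β j) :
        FreeMonoid (DyckLetter m)) : WithZero (FreeMonoid (DyckLetter m))) 0

/-- Equality in the Dyck monoid: the congruence generated by the defining relations. -/
def dyckCon (m : ℕ) : Con (WithZero (FreeMonoid (DyckLetter m))) := conGen (DyckRel m)

/-- The Dyck language: the words that are nonzero in the Dyck monoid. -/
def dyckLanguage (m : ℕ) : Set (FreeMonoid (DyckLetter m)) :=
  {w | ¬ dyckCon m (w : WithZero (FreeMonoid (DyckLetter m))) 0}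

/-- The word `x_r x_{r+1} … x_{r+n-1}`. -/
def block {A : Type*} (x : ℤ → A) (r : ℤ) (n : ℕ) : FreeMonoid A :=
  FreeMonoid.ofList ((List.range n).map fun i => x (r + i))

/-- The two-sided Dyck shift. -/
def dyckShift (m : ℕ) : Set (ℤ → DyckLetter m) :=
  {x | ∀ (r : ℤ) (n : ℕ), block x r n ∈ dyckLanguage m}

theorem shift_mem_dyckShift {m : ℕ} {x : ℤ → DyckLetter m} (hx : x ∈ dyckShift m) :
    (fun n => x (n + 1)) ∈ dyckShift m := by
  intro r n
  have h := hx (r + 1) n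
  have e : block (fun n => x (n + 1)) r n = block x (r + 1) n := by
    unfold block
    refine congrArg _ (List.map_congr_left fun i _ => congrArg x ?_)
    ring
  rw [e]
  exact h

/-- The left shift on the Dyck shift. -/
def dyckT (m : ℕ) (x : dyckShift m) : dyckShift m :=
  ⟨fun n => x.1 (n + 1), shift_mem_dyckShift x.2⟩

/-! ### The measure

Elements of `{0,1}^ℤ` are maps `z : ℤ → Bool`, with `true` for `1`. -/

/-- The height cocycle; `height z 0 = 0` and `height z (i + 1) - height z i` is `1` if `z i = 1`
and `-1` if `z i = 0`. -/
noncomputable def height (z : ℤ → Bool) (i : ℤ) : ℤ :=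
  (∑ j ∈ Finset.Ico 0 i, if z j then 1 else -1) - (∑ j ∈ Finset.Ico i 0, if z j then 1 else -1)

/-- The sequences whose height has lower limit `-∞` in both directions. -/
def recurrentSet : Set (ℤ → Bool) :=
  {z | liminf (fun i : ℤ => ((height z i : ℝ) : EReal)) atTop = ⊥ ∧
    liminf (fun i : ℤ => ((height z i : ℝ) : EReal)) atBot = ⊥}

/-- Enumeration of the ones of `z`: `z_0 + … + z_k` for `k ≥ 0`, `-(z_k + … + z_{-1})` for
`k < 0`. -/
noncomputable def onesIndex (z : ℤ → Bool) (k : ℤ) : ℤ :=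
  if 0 ≤ k then ∑ i ∈ Finset.Icc 0 k, (if z i then 1 else 0)
  else -∑ i ∈ Finset.Icc k (-1), (if z i then 1 else 0)

/-- The last `l < n` with `height z l ≤ height z (n + 1)`. This is a maximum whenever `z` is in
`recurrentSet`. -/
noncomputable def matchIndex (z : ℤ → Bool) (n : ℤ) : ℤ :=
  sSup {l : ℤ | l < n ∧ height z l ≤ height z (n + 1)}

/-- The sequence with brackets placed according to `z` and types chosen by `a`, matching brackets
getting the same type. It is only used for `p.1` in `recurrentSet`. -/
noncomputable def dyckF {m : ℕ} (p : (ℤ → Bool) × (ℤ → Fin m)) (n : ℤ) : DyckLetter m :=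
  if p.1 n then DyckLetter.α (p.2 (onesIndex p.1 n))
  else DyckLetter.β (p.2 (onesIndex p.1 (matchIndex p.1 n)))

/-- The symmetric product measure on `A^ℤ`. -/
noncomputable def symmetricProduct (A : Type*) [MeasurableSpace A] : Measure (ℤ → A) :=
  Measure.infinitePi fun _ => ProbabilityTheory.uniformOn (Set.univ : Set A)

/-- The image of the product of the two symmetric product measures under the map `dyckF`, whose
domain is `recurrentSet ×ˢ univ`, as a measure on the full shift. -/
noncomputable def muFull (m : ℕ) : Measure (ℤ → DyckLetter m) :=
  (((symmetricProduct Bool).prod (symmetricProduct (Fin m))).restrict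
    (recurrentSet ×ˢ Set.univ)).map dyckF

/-- The same measure on the Dyck shift: `muTilde m B = muFull m B` for Borel sets `B` of the Dyck
shift. -/
noncomputable def muTilde (m : ℕ) : Measure (dyckShift m) :=
  (muFull m).comap Subtype.val

/-!
Let `α j` push the symbol `j` on an infinite stack and let `β j` pop it, failing if something else
is on top. A word is nonzero in the Dyck monoid if and only if it acts on some stack. In a sequence
`F(z, a)` with `z` generic the types of the opening brackets are independent and uniform and force
those of the closing ones, so a nonzero word of length `n` has mass `2 ^ (-n) * m ^ (-k)`, where `k`
counts its opening brackets and those closing brackets whose partner lies before the word. This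
depends on the word only through its number of opening brackets and its action on stacks.

Invariance under the shift is then immediate. For double-tail invariance, let `x` and `y` be two
generic points which differ in finitely many coordinates. Their stacks of open brackets agree far to
the right up to a shift, and the shift is trivial because no stack is eventually periodic. Hence `x`
and `y` differ by words with the same action, and exchanging two such words preserves the measure.

The mass formula gives the entropy of the partition into words of length `n`: it is `n * log 2` plus
`log m` times the expected value of `k`. The opening brackets contribute `n / 2`, and the unmatched
closing ones `o(n)`, since their number is the depth reached by a simple random walk. On the other
hand each letter can freely be any of the `m` opening brackets or a closing one, of forced type, so
the topological entropy is at least `log (m + 1)`, which exceeds `log 2 + 1 / 2 * log m`.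
-/

/-! ### The action of words on infinite stacks -/

section Sequences

variable {A : Type*}

/-- The sequence `s` with `a` put in front of it; this is used to push a letter on an infinite
stack and to add a first step to a walk. -/
def seqCons (a : A) (s : ℕ → A) : ℕ → A
  | 0 => a
  | i + 1 => s i

@[simp] theorem seqCons_zero (a : A) (s : ℕ → A) : seqCons a s 0 = a := rfl

@[simp] theorem seqCons_succ (a : A) (s : ℕ → A) (i : ℕ) : seqCons a s (i + 1) = s i := rfl

end Sequences

namespace DyckLetter

variable {m : ℕ}

/-- The type `j` of a bracket `α j` or `β j`. -/
def label : DyckLetter m → Fin m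
  | α j => j
  | β j => j

/-- Whether a bracket is opening, as a Boolean so that it can be compared with a point of
`{0,1}^ℤ`. -/
def isOpening : DyckLetter m → Bool
  | α _ => true
  | β _ => false

@[simp] theorem label_α (j : Fin m) : (α j).label = j := rfl

@[simp] theorem label_β (j : Fin m) : (β j).label = j := rfl

@[simp] theorem isOpening_α (j : Fin m) : (α j).isOpening = true := rfl

@[simp] theorem isOpening_β (j : Fin m) : (β j).isOpening = false := rfl

theorem eq_α_label {l : DyckLetter m} (h : l.isOpening = true) : l = α l.label := by
  cases l <;> simp_all

theorem eq_β_label {l : DyckLetter m} (h : l.isOpening = false) : l = β l.label := by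
  cases l <;> simp_all

/-- The alphabet as a disjoint union of two copies of `Fin m`. -/
def equivSum (m : ℕ) : DyckLetter m ≃ Fin m ⊕ Fin m where
  toFun
    | α j => .inl j
    | β j => .inr j
  invFun
    | .inl j => α j
    | .inr j => β j
  left_inv x := by cases x <;> rfl
  right_inv x := by cases x <;> rfl

instance : Fintype (DyckLetter m) := Fintype.ofEquiv _ (equivSum m).symm

instance : DecidableEq (DyckLetter m) := (equivSum m).decidableEq

instance : DiscreteMeasurableSpace (DyckLetter m) := ⟨fun _ => trivial⟩

instance [NeZero m] : Nonempty (DyckLetter m) := ⟨α 0⟩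

end DyckLetter

section Words

open DyckLetter

variable {m : ℕ}

/-- The action of a bracket on an infinite stack: `α j` pushes `j`, and `β j` pops `j` and fails if
the top of the stack is something else. -/
def stackStep (s : ℕ → Fin m) : DyckLetter m → Option (ℕ → Fin m)
  | α j => some (seqCons j s)
  | β j => if s 0 = j then some fun i => s (i + 1) else none

/-- The action of a word on an infinite stack, its letters being read from left to right. -/
def stackRun (w : List (DyckLetter m)) (s : ℕ → Fin m) : Option (ℕ → Fin m) :=
  w.foldlM stackStep s

@[simp] theorem stackRun_nil (s : ℕ → Fin m) : stackRun [] s = some s := rfl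

@[simp] theorem stackRun_cons_α (j : Fin m) (w : List (DyckLetter m)) (s : ℕ → Fin m) :
    stackRun (α j :: w) s = stackRun w (seqCons j s) := rfl

theorem stackRun_cons_β (j : Fin m) (w : List (DyckLetter m)) (s : ℕ → Fin m) :
    stackRun (β j :: w) s = if s 0 = j then stackRun w (fun i => s (i + 1)) else none := by
  change (stackStep s (β j)).bind (stackRun w) = _
  rw [stackStep]
  split_ifs <;> rfl

@[simp] theorem stackRun_cons_β_ne_none {j : Fin m} {w : List (DyckLetter m)} {s : ℕ → Fin m} :
    stackRun (β j :: w) s ≠ none ↔ s 0 = j ∧ stackRun w (fun i => s (i + 1)) ≠ none := by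
  rw [stackRun_cons_β]
  split_ifs with h <;> simp [h]

theorem stackRun_append (u v : List (DyckLetter m)) (s : ℕ → Fin m) :
    stackRun (u ++ v) s = (stackRun u s).bind (stackRun v) :=
  List.foldlM_append

/-- The action of the free monoid with zero on infinite stacks; `0` fails everywhere. -/
def stackAct (w : WithZero (FreeMonoid (DyckLetter m))) (s : ℕ → Fin m) :
    Option (ℕ → Fin m) :=
  WithZero.recZeroCoe (motive := fun _ => Option (ℕ → Fin m)) none
    (fun w => stackRun (FreeMonoid.toList w) s) w

@[simp] theorem stackAct_zero (s : ℕ → Fin m) : stackAct 0 s = none := rfl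

@[simp] theorem stackAct_coe (w : FreeMonoid (DyckLetter m)) (s : ℕ → Fin m) :
    stackAct (w : WithZero (FreeMonoid (DyckLetter m))) s = stackRun (FreeMonoid.toList w) s := rfl

@[simp] theorem stackAct_one (s : ℕ → Fin m) : stackAct 1 s = some s := rfl

theorem stackAct_mul (u v : WithZero (FreeMonoid (DyckLetter m))) (s : ℕ → Fin m) :
    stackAct (u * v) s = (stackAct u s).bind (stackAct v) := by
  induction u using WithZero.recZeroCoe with
  | zero => simp
  | coe u =>
    induction v using WithZero.recZeroCoe with
    | zero => cases h : stackAct (u : WithZero (FreeMonoid (DyckLetter m))) s <;> simp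
    | coe v =>
      rw [← WithZero.coe_mul, stackAct_coe, FreeMonoid.toList_mul, stackRun_append]
      rfl

/-- The congruence identifying words which act in the same way on stacks. -/
def stackCon (m : ℕ) : Con (WithZero (FreeMonoid (DyckLetter m))) where
  r u v := ∀ s, stackAct u s = stackAct v s
  iseqv := ⟨fun _ _ => rfl, fun h s => (h s).symm, fun h h' s => (h s).trans (h' s)⟩
  mul' h h' s := by
    rw [stackAct_mul, stackAct_mul, h s]
    exact congrArg _ (funext h')

theorem dyckCon_le_stackCon (m : ℕ) : dyckCon m ≤ stackCon m := by
  refine Con.conGen_le.2 fun u v h => ?_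
  rcases h with ⟨j⟩ | ⟨i, j, hij⟩ <;> intro s
  · simp [stackRun_cons_β, -WithZero.coe_mul]
  · simp [stackRun_cons_β, hij, -WithZero.coe_mul]

/-- The normal form `β_{b₁} … β_{bₖ} α_{a₁} … α_{aₗ}` of a nonzero element of the Dyck monoid. -/
def reducedWord (b a : List (Fin m)) : FreeMonoid (DyckLetter m) :=
  FreeMonoid.ofList (b.map β ++ a.map α)

theorem exists_stackRun_reducedWord_ne_none [NeZero m] (b a : List (Fin m)) :
    ∃ s, stackRun (FreeMonoid.toList (reducedWord b a)) s ≠ none := by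
  have pushes : ∀ s : ℕ → Fin m, stackRun (a.map α) s ≠ none := by
    induction a with
    | nil => simp
    | cons j _ ih => exact fun s => ih (seqCons j s)
  induction b with
  | nil => exact ⟨fun _ => 0, pushes _⟩
  | cons j b ih =>
    obtain ⟨s, hs⟩ := ih
    exact ⟨seqCons j s, stackRun_cons_β_ne_none.2 ⟨rfl, hs⟩⟩

theorem dyckCon_of_mul_reducedWord (l : DyckLetter m) (b a : List (Fin m)) :
    dyckCon m (FreeMonoid.of l * reducedWord b a : FreeMonoid (DyckLetter m)) 0 ∨
      ∃ b' a', dyckCon m (FreeMonoid.of l * reducedWord b a : FreeMonoid (DyckLetter m))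
        (reducedWord b' a' : FreeMonoid (DyckLetter m)) := by
  rcases l with j | j
  · rcases b with _ | ⟨i, b⟩
    · exact .inr ⟨[], j :: a, (dyckCon m).refl _⟩
    · have split : FreeMonoid.of (α j) * reducedWord (i :: b) a =
          FreeMonoid.of (α j) * FreeMonoid.of (β i) * reducedWord b a := rfl
      have tail := (dyckCon m).refl (reducedWord b a : WithZero (FreeMonoid (DyckLetter m)))
      rw [split, WithZero.coe_mul]
      by_cases hij : j = i
      · subst hij
        have cancel := (dyckCon m).mul (ConGen.Rel.of _ _ (DyckRel.cancel j)) tail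
        rw [one_mul] at cancel
        exact .inr ⟨b, a, cancel⟩
      · have mismatch := (dyckCon m).mul (ConGen.Rel.of _ _ (DyckRel.mismatch j i hij)) tail
        rw [zero_mul] at mismatch
        exact .inl mismatch
  · exact .inr ⟨j :: b, a, (dyckCon m).refl _⟩

theorem dyckCon_zero_or_reducedWord (w : FreeMonoid (DyckLetter m)) :
    dyckCon m w 0 ∨ ∃ b a, dyckCon m w (reducedWord b a : FreeMonoid (DyckLetter m)) := by
  induction w using FreeMonoid.recOn with
  | one => exact .inr ⟨[], [], (dyckCon m).refl _⟩
  | of_mul l w ih =>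
    have mul_left {v} (h : dyckCon m w v) : dyckCon m (FreeMonoid.of l * w : FreeMonoid _)
        (FreeMonoid.of l * v) := by
      rw [WithZero.coe_mul]
      exact (dyckCon m).mul ((dyckCon m).refl _) h
    rcases ih with zero | ⟨b, a, red⟩
    · left; simpa using mul_left zero
    · have key := mul_left red
      rw [← WithZero.coe_mul] at key
      exact (dyckCon_of_mul_reducedWord l b a).imp ((dyckCon m).trans key)
        fun ⟨b', a', h⟩ => ⟨b', a', (dyckCon m).trans key h⟩

theorem mem_dyckLanguage_iff [NeZero m] {w : FreeMonoid (DyckLetter m)} :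
    w ∈ dyckLanguage m ↔ ∃ s, stackRun (FreeMonoid.toList w) s ≠ none := by
  constructor
  · intro hw
    obtain ⟨b, a, hba⟩ := (dyckCon_zero_or_reducedWord w).resolve_left hw
    obtain ⟨s, hs⟩ := exists_stackRun_reducedWord_ne_none b a
    have := dyckCon_le_stackCon m hba s
    rw [stackAct_coe, stackAct_coe] at this
    exact ⟨s, this ▸ hs⟩
  · rintro ⟨s, hs⟩ h
    exact hs (dyckCon_le_stackCon m h s)

/-! ### Heights of words and unmatched closing brackets -/

/-- The number of opening minus the number of closing brackets of a word. -/
def wordHeight (w : List (DyckLetter m)) : ℤ := 2 * (w.countP isOpening : ℕ) - w.length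

@[simp] theorem wordHeight_nil : wordHeight ([] : List (DyckLetter m)) = 0 := rfl

@[simp] theorem wordHeight_cons_α (j : Fin m) (w : List (DyckLetter m)) :
    wordHeight (α j :: w) = wordHeight w + 1 := by
  simp only [wordHeight, List.countP_cons, isOpening_α, List.length_cons]
  push_cast
  ring

@[simp] theorem wordHeight_cons_β (j : Fin m) (w : List (DyckLetter m)) :
    wordHeight (β j :: w) = wordHeight w - 1 := by
  simp only [wordHeight, List.countP_cons, isOpening_β, List.length_cons]
  push_cast
  ring

/-- The number of closing brackets of a word which are not matched within the word. -/
def unmatchedCount : List (DyckLetter m) → ℕ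
  | [] => 0
  | α _ :: w => unmatchedCount w - 1
  | β _ :: w => unmatchedCount w + 1

theorem unmatchedCount_add_wordHeight_nonneg (w : List (DyckLetter m)) :
    0 ≤ unmatchedCount w + wordHeight w := by
  induction w with
  | nil => simp
  | cons l w ih => cases l <;> simp [unmatchedCount] <;> omega

theorem unmatchedCount_le_of_forall_prefix {w : List (DyckLetter m)} {i : ℕ}
    (h : ∀ p, p <+: w → 0 ≤ (i : ℤ) + wordHeight p) : unmatchedCount w ≤ i := by
  induction w generalizing i with
  | nil => simp [unmatchedCount]
  | cons l w ih =>
    have tail {p} (hp : p <+: w) := h (l :: p) ((List.prefix_cons_inj l).2 hp)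
    cases l with
    | α j =>
      have := ih (i := i + 1) fun p hp => by
        have := tail hp
        rw [wordHeight_cons_α] at this
        omega
      simp only [unmatchedCount]
      omega
    | β j =>
      have top := tail List.nil_prefix
      rw [wordHeight_cons_β, wordHeight_nil] at top
      have := ih (i := i - 1) fun p hp => by
        have := tail hp
        rw [wordHeight_cons_β] at this
        omega
      simp only [unmatchedCount]
      omega

theorem stackRun_ne_none_iff {w : List (DyckLetter m)} {s s' : ℕ → Fin m}
    (hs : stackRun w s ≠ none) :
    stackRun w s' ≠ none ↔ ∀ i < unmatchedCount w, s' i = s i := by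
  induction w generalizing s s' with
  | nil => simp [unmatchedCount]
  | cons l w ih =>
    cases l with
    | α j =>
      simp only [stackRun_cons_α, unmatchedCount] at hs ⊢
      rw [ih hs]
      refine ⟨fun h i hi => h (i + 1) (by omega), fun h i hi => ?_⟩
      cases i with
      | zero => rfl
      | succ i => exact h i (by omega)
    | β j =>
      rw [stackRun_cons_β_ne_none] at hs ⊢
      rw [ih hs.2, ← hs.1]
      simp only [unmatchedCount]
      refine ⟨fun h i hi => ?_, fun h => ⟨h 0 (by omega), fun i hi => h (i + 1) (by omega)⟩⟩
      cases i with
      | zero => exact h.1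
      | succ i => exact h.2 i (by omega)

theorem stackRun_apply {w : List (DyckLetter m)} {s t : ℕ → Fin m} (h : stackRun w s = some t)
    {i k : ℕ} (hi : unmatchedCount w ≤ i) (hk : (k : ℤ) = i + wordHeight w) : t k = s i := by
  induction w generalizing s i with
  | nil =>
    simp only [stackRun_nil, Option.some.injEq] at h
    simp only [wordHeight_nil, add_zero, Nat.cast_inj] at hk
    rw [h, hk]
  | cons l w ih =>
    cases l with
    | α j =>
      simp only [unmatchedCount, wordHeight_cons_α] at hi hk
      exact ih (i := i + 1) h (by omega) (by push_cast; omega)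
    | β j =>
      simp only [unmatchedCount, wordHeight_cons_β] at hi hk
      rw [stackRun_cons_β] at h
      split_ifs at h
      obtain ⟨i, rfl⟩ : ∃ i', i = i' + 1 := ⟨i - 1, by omega⟩
      exact ih (i := i) h (by omega) (by push_cast at hk; omega)

theorem stackRun_apply_congr {w : List (DyckLetter m)} {s s' t t' : ℕ → Fin m}
    (h : stackRun w s = some t) (h' : stackRun w s' = some t') {k : ℕ}
    (hk : (k : ℤ) < unmatchedCount w + wordHeight w) : t k = t' k := by
  induction w generalizing s s' with
  | nil =>
    simp only [unmatchedCount, wordHeight_nil] at hk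
    omega
  | cons l w ih =>
    cases l with
    | α j =>
      simp only [unmatchedCount, wordHeight_cons_α] at hk
      rcases lt_or_ge (k : ℤ) (unmatchedCount w + wordHeight w) with hlt | hge
      · exact ih h h' hlt
      · rw [stackRun_cons_α] at h h'
        rw [stackRun_apply h (i := 0) (k := k) (by omega) (by omega),
          stackRun_apply h' (i := 0) (k := k) (by omega) (by omega), seqCons_zero, seqCons_zero]
    | β j =>
      simp only [unmatchedCount, wordHeight_cons_β] at hk
      rw [stackRun_cons_β] at h h'
      split_ifs at h h'
      exact ih h h' (by push_cast at hk; omega)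

theorem unmatchedCount_eq_of_stackRun_eq [Nontrivial (Fin m)] {u v : List (DyckLetter m)}
    (h : ∀ s, stackRun u s = stackRun v s) {s : ℕ → Fin m} (hs : stackRun u s ≠ none) :
    unmatchedCount u = unmatchedCount v := by
  have le {u v : List (DyckLetter m)} (h : ∀ s, stackRun u s = stackRun v s)
      (hu : stackRun u s ≠ none) : unmatchedCount v ≤ unmatchedCount u := by
    by_contra! hlt
    obtain ⟨j, hj⟩ := exists_ne (s (unmatchedCount u))
    have hu' : stackRun u (Function.update s (unmatchedCount u) j) ≠ none :=
      (stackRun_ne_none_iff hu).2 fun i hi => Function.update_of_ne hi.ne _ _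
    rw [h] at hu hu'
    have := (stackRun_ne_none_iff hu).1 hu' _ hlt
    rw [Function.update_self] at this
    exact hj this
  exact le_antisymm (le (fun s => (h s).symm) (h s ▸ hs)) (le h hs)

/-- The action of a word depends on finitely many entries of the stack only, which is why equality
at one stack extends to a cylinder. -/
theorem stackRun_eq_of_eqOn {u v : List (DyckLetter m)} {s t s' : ℕ → Fin m}
    (hu : stackRun u s = some t) (hv : stackRun v s = some t) (huv : wordHeight u = wordHeight v)
    (hs : ∀ i < max (unmatchedCount u) (unmatchedCount v), s' i = s i) :
    stackRun u s' = stackRun v s' := by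
  obtain ⟨tu, htu⟩ := Option.ne_none_iff_exists'.1 <|
    (stackRun_ne_none_iff (s' := s') (by simp [hu])).2 fun i hi => hs i (lt_max_of_lt_left hi)
  obtain ⟨tv, htv⟩ := Option.ne_none_iff_exists'.1 <|
    (stackRun_ne_none_iff (s' := s') (by simp [hv])).2 fun i hi => hs i (lt_max_of_lt_right hi)
  rw [htu, htv]
  congr 1
  funext k
  have low {w : List (DyckLetter m)} {tw : ℕ → Fin m} (hw : stackRun w s = some t)
      (hw' : stackRun w s' = some tw)
      (hk : (k : ℤ) - wordHeight w < (max (unmatchedCount u) (unmatchedCount v) : ℕ)) :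
      tw k = t k := by
    rcases lt_or_ge (k : ℤ) (unmatchedCount w + wordHeight w) with hlt | hge
    · exact stackRun_apply_congr hw' hw hlt
    · obtain ⟨i, hi⟩ := Int.eq_ofNat_of_zero_le (show 0 ≤ (k : ℤ) - wordHeight w by omega)
      rw [stackRun_apply hw' (i := i) (by omega) (by omega),
        stackRun_apply hw (i := i) (by omega) (by omega), hs i (by omega)]
  rcases lt_or_ge ((k : ℤ) - wordHeight u) (max (unmatchedCount u) (unmatchedCount v) : ℕ)
    with hlt | hge
  · rw [low hu htu hlt, low hv htv (huv ▸ hlt)]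
  · obtain ⟨i, hi⟩ := Int.eq_ofNat_of_zero_le (show 0 ≤ (k : ℤ) - wordHeight u by omega)
    rw [stackRun_apply htu (i := i) (by omega) (by omega),
      stackRun_apply htv (i := i) (by omega) (by omega)]

end Words

/-! ### Heights -/

section Heights

theorem height_succ (z : ℤ → Bool) (i : ℤ) :
    height z (i + 1) = height z i + if z i then 1 else -1 := by
  unfold height
  rcases le_or_gt 0 i with hi | hi
  · rw [Finset.Ico_eq_empty (by omega : ¬ i + 1 < 0), Finset.Ico_eq_empty (by omega : ¬ i < 0),
      ← Finset.insert_Ico_right_eq_Ico_add_one hi, Finset.sum_insert (by simp)]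
    simp [add_comm]
  · rw [Finset.Ico_eq_empty (by omega : ¬ 0 < i + 1), Finset.Ico_eq_empty (by omega : ¬ 0 < i),
      ← Finset.insert_Ico_add_one_left_eq_Ico hi, Finset.sum_insert (by simp)]
    simp

@[simp] theorem height_zero (z : ℤ → Bool) : height z 0 = 0 := by simp [height]

theorem height_succ_of_true {z : ℤ → Bool} {i : ℤ} (h : z i = true) :
    height z (i + 1) = height z i + 1 := by rw [height_succ, if_pos h]

theorem height_succ_of_false {z : ℤ → Bool} {i : ℤ} (h : z i = false) :
    height z (i + 1) = height z i - 1 := by rw [height_succ, h]; rfl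

theorem abs_height_le (z : ℤ → Bool) (i : ℤ) : |height z i| ≤ |i| := by
  induction i using Int.induction_on with
  | zero => simp
  | succ n ih =>
    have := height_succ z n
    split_ifs at this <;> grind
  | pred n ih =>
    have := height_succ z (-n - 1)
    rw [sub_add_cancel] at this
    split_ifs at this <;> grind

theorem height_sub_height_congr {z z' : ℤ → Bool} {l r : ℤ} (hlr : l ≤ r)
    (h : ∀ k, l ≤ k → k < r → z k = z' k) :
    height z r - height z l = height z' r - height z' l := by
  induction r, hlr using Int.leInduction with
  | base => simp
  | succ r hr ih =>
    have := ih fun k hk hk' => h k hk (by omega)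
    rw [height_succ, height_succ, h r hr (by omega)]
    omega

/-- The height is unbounded below on the left. -/
def LeftUnbounded (z : ℤ → Bool) : Prop := ∀ r c : ℤ, ∃ l < r, height z l ≤ c

/-- The height is unbounded below on the right. -/
def RightUnbounded (z : ℤ → Bool) : Prop := ∀ r c : ℤ, ∃ l > r, height z l ≤ c

theorem liminf_height_eq_bot_iff (z : ℤ → Bool) (f : Filter ℤ) :
    liminf (fun i : ℤ => ((height z i : ℝ) : EReal)) f = ⊥ ↔
      ∀ c : ℤ, ∃ᶠ i in f, height z i ≤ c := by
  constructor
  · intro h c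
    by_contra hc
    rw [not_frequently] at hc
    have : ((c : ℝ) : EReal) ≤ liminf (fun i : ℤ => ((height z i : ℝ) : EReal)) f := by
      refine le_liminf_of_le ⟨⊤, fun _ _ => le_top⟩ (hc.mono fun i hi => ?_)
      exact_mod_cast (not_le.1 hi).le
    rw [h, le_bot_iff] at this
    exact EReal.coe_ne_bot _ this
  · intro h
    rw [EReal.eq_bot_iff_forall_lt]
    intro y
    obtain ⟨c, hc⟩ := exists_int_lt y
    refine lt_of_le_of_lt (b := ((c : ℝ) : EReal)) ?_ (by exact_mod_cast hc)
    exact liminf_le_of_frequently_le' ((h c).mono fun i hi => by exact_mod_cast hi)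

theorem mem_recurrentSet_iff {z : ℤ → Bool} :
    z ∈ recurrentSet ↔ RightUnbounded z ∧ LeftUnbounded z := by
  unfold recurrentSet RightUnbounded LeftUnbounded
  rw [Set.mem_ofPred_eq, liminf_height_eq_bot_iff, liminf_height_eq_bot_iff]
  simp only [frequently_atTop', frequently_atBot']
  exact and_congr forall_comm forall_comm

theorem leftUnbounded_of_forall {z : ℤ → Bool} (h : ∀ c : ℕ, ∃ l ≤ 0, height z l < -c) :
    LeftUnbounded z := by
  intro r c
  obtain ⟨l, hl, hlc⟩ := h (r.natAbs + c.natAbs)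
  have := abs_le.1 (abs_height_le z l)
  rw [abs_of_nonpos hl] at this
  exact ⟨l, by omega, by omega⟩

theorem rightUnbounded_of_forall {z : ℤ → Bool} (h : ∀ c : ℕ, ∃ l ≥ 0, height z l < -c) :
    RightUnbounded z := by
  intro r c
  obtain ⟨l, hl, hlc⟩ := h (r.natAbs + c.natAbs)
  have := abs_le.1 (abs_height_le z l)
  rw [abs_of_nonneg hl] at this
  exact ⟨l, by omega, by omega⟩

theorem LeftUnbounded.congr {z z' : ℤ → Bool} (hz : LeftUnbounded z) {r : ℤ}
    (h : ∀ k < r, z k = z' k) : LeftUnbounded z' := by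
  intro r' c
  obtain ⟨l, hl, hlc⟩ := hz (min r r') (c + height z r - height z' r)
  have := height_sub_height_congr (l := l) (r := r) (by omega) fun k _ hk => h k hk
  exact ⟨l, by omega, by omega⟩

/-! ### Positions of the open brackets -/

/-- The position of the bracket at depth `i` among those which are open at time `r`. -/
noncomputable def openPos (z : ℤ → Bool) (r : ℤ) (i : ℕ) : ℤ :=
  sSup {l : ℤ | l < r ∧ height z l ≤ height z r - 1 - i}

theorem matchIndex_eq_openPos {z : ℤ → Bool} {n : ℤ} (h : z n = false) :
    matchIndex z n = openPos z n 0 := by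
  simp [matchIndex, openPos, height_succ_of_false h]

theorem openPos_congr {z z' : ℤ → Bool} {r : ℤ} (h : ∀ k < r, z k = z' k) :
    openPos z r = openPos z' r := by
  funext i
  unfold openPos
  congr 1
  ext l
  simp only [Set.mem_ofPred_eq, and_congr_right_iff]
  intro hl
  have := height_sub_height_congr hl.le fun k _ hk => h k hk
  omega

variable {z : ℤ → Bool}

theorem isGreatest_openPos (hz : LeftUnbounded z) (r : ℤ) (i : ℕ) :
    IsGreatest {l : ℤ | l < r ∧ height z l ≤ height z r - 1 - i} (openPos z r i) := by
  have bdd : BddAbove {l : ℤ | l < r ∧ height z l ≤ height z r - 1 - i} :=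
    ⟨r, fun l hl => hl.1.le⟩
  exact ⟨Int.csSup_mem (hz r _) bdd, fun l hl => le_csSup bdd hl⟩

theorem openPos_lt (hz : LeftUnbounded z) (r : ℤ) (i : ℕ) : openPos z r i < r :=
  (isGreatest_openPos hz r i).1.1

theorem lt_height_of_openPos_lt (hz : LeftUnbounded z) {r l : ℤ} {i : ℕ} (h : openPos z r i < l)
    (h' : l < r) : height z r - 1 - i < height z l := by
  by_contra! hc
  exact h.not_ge ((isGreatest_openPos hz r i).2 ⟨h', hc⟩)

theorem openPos_eq (hz : LeftUnbounded z) {r : ℤ} {i : ℕ} {p : ℤ} (hp : p < r)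
    (hle : height z p ≤ height z r - 1 - i)
    (hlt : ∀ l, p < l → l < r → height z r - 1 - i < height z l) : openPos z r i = p := by
  refine (isGreatest_openPos hz r i).unique ⟨⟨hp, hle⟩, fun l hl => ?_⟩
  by_contra! hpl
  exact (hlt l hpl hl.1).not_ge hl.2

theorem height_succ_openPos_ge (hz : LeftUnbounded z) (r : ℤ) (i : ℕ) :
    height z r - i ≤ height z (openPos z r i + 1) := by
  rcases (Int.add_one_le_of_lt (openPos_lt hz r i)).eq_or_lt with h | h
  · rw [h]
    omega
  · have := lt_height_of_openPos_lt hz (lt_add_one _) h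
    omega

theorem apply_openPos (hz : LeftUnbounded z) (r : ℤ) (i : ℕ) : z (openPos z r i) = true := by
  by_contra! h
  have := height_succ_of_false (eq_false_of_ne_true h)
  have := height_succ_openPos_ge hz r i
  have := (isGreatest_openPos hz r i).1.2
  omega

theorem height_openPos (hz : LeftUnbounded z) (r : ℤ) (i : ℕ) :
    height z (openPos z r i) = height z r - 1 - i := by
  have := height_succ_of_true (apply_openPos hz r i)
  have := height_succ_openPos_ge hz r i
  have := (isGreatest_openPos hz r i).1.2
  omega

theorem openPos_injective (hz : LeftUnbounded z) (r : ℤ) : Function.Injective (openPos z r) := by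
  intro i j h
  have := height_openPos hz r i
  rw [h, height_openPos hz r j] at this
  omega

theorem openPos_succ_zero (hz : LeftUnbounded z) {r : ℤ} (h : z r = true) :
    openPos z (r + 1) 0 = r := by
  have := height_succ_of_true h
  exact openPos_eq hz (by omega) (by simp; omega) fun l _ _ => by omega

theorem openPos_succ_succ (hz : LeftUnbounded z) {r : ℤ} (h : z r = true) (i : ℕ) :
    openPos z (r + 1) (i + 1) = openPos z r i := by
  have hr := height_succ_of_true h
  have hlt := openPos_lt hz r i
  have hp := height_openPos hz r i
  refine openPos_eq hz (by omega) (by push_cast; omega) fun l hl hl' => ?_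
  push_cast
  rcases (Int.lt_add_one_iff.1 hl').eq_or_lt with rfl | hl''
  · omega
  · have := lt_height_of_openPos_lt hz hl hl''
    omega

theorem openPos_succ_of_false (hz : LeftUnbounded z) {r : ℤ} (h : z r = false) (i : ℕ) :
    openPos z (r + 1) i = openPos z r (i + 1) := by
  have hr := height_succ_of_false h
  have hlt := openPos_lt hz r (i + 1)
  have hp := height_openPos hz r (i + 1)
  push_cast at hp
  refine openPos_eq hz (by omega) (by omega) fun l hl hl' => ?_
  rcases (Int.lt_add_one_iff.1 hl').eq_or_lt with rfl | hl''
  · omega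
  · have := lt_height_of_openPos_lt hz hl hl''
    push_cast at this
    omega

end Heights

/-! ### Enumeration of the ones -/

theorem strictMonoOn_onesIndex (z : ℤ → Bool) : StrictMonoOn (onesIndex z) {k | z k = true} := by
  intro k (hk : z k = true) k' (hk' : z k' = true) hkk'
  have nonneg (i : ℤ) : (0 : ℤ) ≤ if z i then 1 else 0 := by split_ifs <;> simp
  unfold onesIndex
  split_ifs with h h' h'
  · refine Finset.sum_lt_sum_of_subset (i := k') (Finset.Icc_subset_Icc_right hkk'.le) ?_ ?_ ?_
      fun i _ _ => nonneg i
    · simp only [Finset.mem_Icc]; omega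
    · simp only [Finset.mem_Icc]; omega
    · simp [hk']
  · omega
  · have one_le : (if z k then (1 : ℤ) else 0) ≤ ∑ i ∈ Finset.Icc k (-1), if z i then 1 else 0 :=
      Finset.single_le_sum (f := fun i => if z i then (1 : ℤ) else 0) (fun i _ => nonneg i)
        (by simp only [Finset.mem_Icc]; omega)
    rw [if_pos hk] at one_le
    have : (0 : ℤ) ≤ ∑ i ∈ Finset.Icc 0 k', if z i then 1 else 0 :=
      Finset.sum_nonneg fun i _ => nonneg i
    omega
  · refine neg_lt_neg (Finset.sum_lt_sum_of_subset (i := k)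
      (Finset.Icc_subset_Icc_left hkk'.le) ?_ ?_ ?_ fun i _ _ => nonneg i)
    · simp only [Finset.mem_Icc]; omega
    · simp only [Finset.mem_Icc]; omega
    · simp [hk]

/-! ### Blocks of sequences -/

section Blocks

variable {A : Type*}

/-- The block `x_r … x_{r+n-1}` as a list. -/
def blockList (x : ℤ → A) (r : ℤ) (n : ℕ) : List A :=
  (List.range n).map fun i : ℕ => x (r + i)

theorem toList_block (x : ℤ → A) (r : ℤ) (n : ℕ) :
    FreeMonoid.toList (block x r n) = blockList x r n := by
  simp [block, blockList, ← List.map_eq_flatMap]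

@[simp] theorem blockList_zero (x : ℤ → A) (r : ℤ) : blockList x r 0 = [] := rfl

theorem blockList_succ (x : ℤ → A) (r : ℤ) (n : ℕ) :
    blockList x r (n + 1) = x r :: blockList x (r + 1) n := by
  unfold blockList
  rw [List.range_succ_eq_map, List.map_cons, List.map_map, Nat.cast_zero, add_zero]
  refine congrArg _ (List.map_congr_left fun i _ => congrArg x ?_)
  push_cast
  ring

@[simp] theorem length_blockList (x : ℤ → A) (r : ℤ) (n : ℕ) : (blockList x r n).length = n := by
  simp [blockList]

theorem blockList_add (x : ℤ → A) (r : ℤ) (p q : ℕ) :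
    blockList x r (p + q) = blockList x r p ++ blockList x (r + p) q := by
  unfold blockList
  rw [List.range_add, List.map_append, List.map_map]
  refine congrArg _ (List.map_congr_left fun i _ => congrArg x ?_)
  push_cast
  ring

theorem blockList_eq_iff {x y : ℤ → A} {r : ℤ} {n : ℕ} :
    blockList x r n = blockList y r n ↔ ∀ k, r ≤ k → k < r + n → x k = y k := by
  unfold blockList
  rw [List.map_inj_left]
  constructor
  · intro h k hk hk'
    have := h (k - r).toNat (List.mem_range.2 (by omega))
    rwa [Int.toNat_of_nonneg (by omega), add_sub_cancel] at this
  · intro h i hi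
    exact h _ (by omega) (by have := List.mem_range.1 hi; omega)

theorem eq_blockList_of_prefix {x : ℤ → A} {r : ℤ} {n : ℕ} {p : List A}
    (h : p <+: blockList x r n) : p = blockList x r p.length := by
  obtain ⟨q, rfl⟩ := Nat.exists_eq_add_of_le (length_blockList x r n ▸ h.length_le)
  rw [blockList_add] at h
  obtain ⟨s, hs⟩ := h
  exact (List.append_inj hs (by simp)).1

variable {m : ℕ}

/-- The positions of the opening brackets. -/
def openPattern (x : ℤ → DyckLetter m) (k : ℤ) : Bool := (x k).isOpening

theorem eq_α_of_openPattern {x : ℤ → DyckLetter m} {k : ℤ} (h : openPattern x k = true) :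
    x k = .α (x k).label := DyckLetter.eq_α_label h

theorem eq_β_of_openPattern {x : ℤ → DyckLetter m} {k : ℤ} (h : openPattern x k = false) :
    x k = .β (x k).label := DyckLetter.eq_β_label h

theorem wordHeight_blockList (x : ℤ → DyckLetter m) (r : ℤ) (n : ℕ) :
    wordHeight (blockList x r n) = height (openPattern x) (r + n) - height (openPattern x) r := by
  induction n generalizing r with
  | zero => simp
  | succ n ih =>
    have ih := ih (r + 1)
    rw [add_assoc, add_comm 1 (n : ℤ)] at ih
    rw [blockList_succ]
    push_cast
    cases h : openPattern x r
    · have := height_succ_of_false h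
      rw [eq_β_of_openPattern h, wordHeight_cons_β]
      omega
    · have := height_succ_of_true h
      rw [eq_α_of_openPattern h, wordHeight_cons_α]
      omega

/-! ### The stack of open brackets -/

/-- The types of the brackets of `x` which are open at time `r`, the last opened one first. -/
noncomputable def openStack (x : ℤ → DyckLetter m) (r : ℤ) (i : ℕ) : Fin m :=
  (x (openPos (openPattern x) r i)).label

/-- Matching brackets have the same type. -/
def IsMatched (x : ℤ → DyckLetter m) : Prop :=
  ∀ n, openPattern x n = false → (x n).label = openStack x n 0

theorem openStack_congr {x y : ℤ → DyckLetter m} {r : ℤ} (hx : LeftUnbounded (openPattern x))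
    (h : ∀ k < r, x k = y k) : openStack x r = openStack y r := by
  funext i
  have pattern (k : ℤ) (hk : k < r) : openPattern x k = openPattern y k := by
    simp only [openPattern, h k hk]
  rw [openStack, openStack, ← openPos_congr pattern, h _ (openPos_lt hx r i)]

theorem openStack_succ_of_true {x : ℤ → DyckLetter m} (hx : LeftUnbounded (openPattern x)) {r : ℤ}
    (h : openPattern x r = true) : openStack x (r + 1) = seqCons (x r).label (openStack x r) := by
  funext i
  cases i with
  | zero => rw [openStack, openPos_succ_zero hx h, seqCons_zero]
  | succ i => rw [openStack, openPos_succ_succ hx h, seqCons_succ, openStack]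

theorem openStack_succ_of_false {x : ℤ → DyckLetter m} (hx : LeftUnbounded (openPattern x)) {r : ℤ}
    (h : openPattern x r = false) : openStack x (r + 1) = fun i => openStack x r (i + 1) := by
  funext i
  rw [openStack, openPos_succ_of_false hx h, openStack]

theorem stackRun_blockList {x : ℤ → DyckLetter m} (hx : LeftUnbounded (openPattern x))
    (hm : IsMatched x) (r : ℤ) (n : ℕ) :
    stackRun (blockList x r n) (openStack x r) = some (openStack x (r + n)) := by
  induction n generalizing r with
  | zero => simp
  | succ n ih =>
    have ih := ih (r + 1)
    rw [add_assoc, add_comm 1 (n : ℤ)] at ih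
    rw [blockList_succ]
    push_cast
    rw [← ih]
    cases h : openPattern x r
    · rw [eq_β_of_openPattern h, stackRun_cons_β, if_pos (hm r h).symm,
        openStack_succ_of_false hx h]
    · rw [eq_α_of_openPattern h, stackRun_cons_α, openStack_succ_of_true hx h]

theorem mem_dyckShift_of_isMatched [NeZero m] {x : ℤ → DyckLetter m}
    (hx : LeftUnbounded (openPattern x)) (hm : IsMatched x) : x ∈ dyckShift m := fun r n =>
  mem_dyckLanguage_iff.2 ⟨openStack x r, by simp [toList_block, stackRun_blockList hx hm]⟩

theorem stackRun_blockList_apply {x : ℤ → DyckLetter m} (hx : LeftUnbounded (openPattern x))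
    {r : ℤ} {n i : ℕ} (hr : r ≤ openPos (openPattern x) (r + n) i) {s t : ℕ → Fin m}
    (h : stackRun (blockList x r n) s = some t) : t i = openStack x (r + n) i := by
  set p := openPos (openPattern x) (r + n) i with hp
  have hpn : p < r + n := openPos_lt hx _ i
  have opening : openPattern x p = true := apply_openPos hx _ i
  obtain ⟨a, ha⟩ := Int.le.dest hr
  obtain ⟨b, hb⟩ := Int.le.dest (Int.add_one_le_of_lt hpn)
  obtain rfl : n = a + (b + 1) := by omega
  rw [blockList_add, blockList_succ, ha, stackRun_append] at h
  obtain ⟨u, -, h⟩ := Option.bind_eq_some_iff.1 h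
  rw [eq_α_of_openPattern opening, stackRun_cons_α] at h
  have hp_height := height_openPos hx (r + (a + (b + 1) : ℕ)) i
  have hp_succ := height_succ_of_true opening
  rw [← hp] at hp_height
  have stays_open : unmatchedCount (blockList x (p + 1) b) ≤ 0 := by
    refine unmatchedCount_le_of_forall_prefix fun w hw => ?_
    have hw_length : w.length ≤ b := length_blockList x (p + 1) b ▸ hw.length_le
    rw [eq_blockList_of_prefix hw, wordHeight_blockList]
    rcases hw_length.eq_or_lt with hwb | hwb
    · rw [hwb, hb]
      omega
    · have := lt_height_of_openPos_lt hx (i := i) (l := p + 1 + w.length)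
        (r := r + (a + (b + 1) : ℕ)) (by omega) (by omega)
      omega
  rw [stackRun_apply h stays_open (by rw [wordHeight_blockList, hb]; push_cast at *; omega),
    seqCons_zero, openStack, ← hp]

theorem isMatched_of_mem_dyckShift [NeZero m] {x : ℤ → DyckLetter m} (hx : x ∈ dyckShift m)
    (hl : LeftUnbounded (openPattern x)) : IsMatched x := by
  intro n hn
  obtain ⟨q, hq⟩ := Int.le.dest (openPos_lt hl n 0).le
  obtain ⟨s, hs⟩ := mem_dyckLanguage_iff.1 (hx (openPos (openPattern x) n 0) (q + 1))
  rw [toList_block, blockList_add, stackRun_append] at hs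
  obtain ⟨t, ht⟩ : ∃ t, stackRun (blockList x (openPos (openPattern x) n 0) q) s = some t := by
    by_contra! h
    exact hs (by rw [Option.eq_none_iff_forall_ne_some.2 h]; rfl)
  rw [ht, Option.bind_some, hq, blockList_succ, blockList_zero, eq_β_of_openPattern hn,
    stackRun_cons_β_ne_none] at hs
  rw [← hs.1, stackRun_blockList_apply hl (by rw [hq]) ht, hq]

theorem blockList_eq_of_stackRun_ne_none {x y : ℤ → DyckLetter m}
    (hx : LeftUnbounded (openPattern x)) (hm : IsMatched x) {r : ℤ} {n : ℕ}
    (pattern : ∀ k, r ≤ k → k < r + n → openPattern x k = openPattern y k)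
    (labels : ∀ k, r ≤ k → k < r + n → openPattern y k = true → (x k).label = (y k).label)
    (run : stackRun (blockList y r n) (openStack x r) ≠ none) :
    blockList x r n = blockList y r n := by
  induction n generalizing r with
  | zero => rfl
  | succ n ih =>
    rw [blockList_succ] at run
    have hr := pattern r (by omega) (by push_cast; omega)
    have ih := ih (r := r + 1) (fun k hk hk' => pattern k (by omega) (by push_cast; omega))
      (fun k hk hk' => labels k (by omega) (by push_cast; omega))
    rw [blockList_succ, blockList_succ]
    cases h : openPattern y r
    · rw [eq_β_of_openPattern h, stackRun_cons_β_ne_none,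
        ← openStack_succ_of_false hx (hr.trans h)] at run
      rw [ih run.2, eq_β_of_openPattern h, ← run.1, ← hm r (hr.trans h),
        ← eq_β_of_openPattern (hr.trans h)]
    · have label := labels r (by omega) (by push_cast; omega) h
      rw [eq_α_of_openPattern h, stackRun_cons_α, ← label,
        ← openStack_succ_of_true hx (hr.trans h)] at run
      rw [ih run, eq_α_of_openPattern h, ← label, ← eq_α_of_openPattern (hr.trans h)]

theorem blockList_eq_iff_of_isMatched {x y : ℤ → DyckLetter m}
    (hx : LeftUnbounded (openPattern x)) (hm : IsMatched x) {r : ℤ} {n : ℕ} :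
    blockList x r n = blockList y r n ↔
      (∀ k, r ≤ k → k < r + n → openPattern x k = openPattern y k) ∧
      (∀ k, r ≤ k → k < r + n → openPattern y k = true → (x k).label = (y k).label) ∧
      stackRun (blockList y r n) (openStack x r) ≠ none := by
  refine ⟨fun h => ⟨fun k hk hk' => ?_, fun k hk hk' _ => ?_, ?_⟩,
    fun h => blockList_eq_of_stackRun_ne_none hx hm h.1 h.2.1 h.2.2⟩
  · rw [openPattern, blockList_eq_iff.1 h k hk hk', openPattern]
  · rw [blockList_eq_iff.1 h k hk hk']
  · simp [← h, stackRun_blockList hx hm]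

/-- Brackets placed according to `z`, an opening bracket at `k` having type `l k`, and matching
brackets having the same type. -/
noncomputable def bracketSeq (z : ℤ → Bool) (l : ℤ → Fin m) (n : ℤ) : DyckLetter m :=
  if z n then .α (l n) else .β (l (matchIndex z n))

theorem bracketSeq_of_true {z : ℤ → Bool} {l : ℤ → Fin m} {n : ℤ} (h : z n = true) :
    bracketSeq z l n = .α (l n) := by rw [bracketSeq, if_pos h]

theorem bracketSeq_of_false {z : ℤ → Bool} {l : ℤ → Fin m} {n : ℤ} (h : z n = false) :
    bracketSeq z l n = .β (l (openPos z n 0)) := by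
  rw [bracketSeq, if_neg (by simp [h]), matchIndex_eq_openPos h]

@[simp] theorem openPattern_bracketSeq (z : ℤ → Bool) (l : ℤ → Fin m) :
    openPattern (bracketSeq z l) = z := by
  funext n
  unfold openPattern
  cases h : z n
  · rw [bracketSeq_of_false h]; rfl
  · rw [bracketSeq_of_true h]; rfl

theorem openStack_bracketSeq {z : ℤ → Bool} (hz : LeftUnbounded z) (l : ℤ → Fin m) (r : ℤ)
    (i : ℕ) : openStack (bracketSeq z l) r i = l (openPos z r i) := by
  rw [openStack, openPattern_bracketSeq, bracketSeq_of_true (apply_openPos hz r i),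
    DyckLetter.label_α]

theorem isMatched_bracketSeq {z : ℤ → Bool} (hz : LeftUnbounded z) (l : ℤ → Fin m) :
    IsMatched (bracketSeq z l) := by
  intro n hn
  rw [openPattern_bracketSeq] at hn
  rw [openStack_bracketSeq hz, bracketSeq_of_false hn, DyckLetter.label_β]

theorem bracketSeq_mem_dyckShift [NeZero m] {z : ℤ → Bool} (hz : LeftUnbounded z)
    (l : ℤ → Fin m) : bracketSeq z l ∈ dyckShift m :=
  mem_dyckShift_of_isMatched (by rwa [openPattern_bracketSeq]) (isMatched_bracketSeq hz l)

theorem dyckF_eq_bracketSeq (p : (ℤ → Bool) × (ℤ → Fin m)) :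
    dyckF p = bracketSeq p.1 (fun k => p.2 (onesIndex p.1 k)) := rfl

end Blocks

/-! ### Product measures -/

section ProductMeasures

open Measure ProbabilityTheory

variable {A ι κ : Type*}

theorem preimage_seqCons_pi_range (t : ℕ → Set A) (N : ℕ) :
    (fun p : A × (ℕ → A) => seqCons p.1 p.2) ⁻¹' Set.pi (Finset.range (N + 1)) t =
      t 0 ×ˢ Set.pi (Finset.range N) fun i => t (i + 1) := by
  ext p
  simp only [Set.mem_preimage, Set.mem_pi, Finset.coe_range, Set.mem_Iio, Set.mem_prod]
  refine ⟨fun h => ⟨h 0 (by omega), fun i hi => h (i + 1) (by omega)⟩, fun h i hi => ?_⟩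
  cases i with
  | zero => exact h.1
  | succ i => exact h.2 i (by omega)

variable [MeasurableSpace A]

theorem map_comp_infinitePi (ν : Measure A) [IsProbabilityMeasure ν] {f : κ → ι}
    (hf : Function.Injective f) :
    (infinitePi fun _ : ι => ν).map (fun a k => a (f k)) = infinitePi fun _ : κ => ν := by
  refine eq_infinitePi _ fun s t ht => ?_
  rw [map_apply (by fun_prop) (.pi s.countable_toSet fun _ _ => ht _)]
  have preimage : (fun (a : ι → A) k => a (f k)) ⁻¹' ((s : Set κ).pi t) =
      Set.pi (s.map ⟨f, hf⟩ : Finset ι) (Function.extend f t fun _ => Set.univ) := by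
    ext a
    simp [Set.mem_pi, hf.extend_apply]
  rw [preimage, infinitePi_pi, Finset.prod_map]
  · simp [hf.extend_apply]
  · intro i hi
    obtain ⟨k, _, rfl⟩ := Finset.mem_map.1 hi
    simpa [hf.extend_apply] using ht k

theorem measurable_seqCons : Measurable fun p : A × (ℕ → A) => seqCons p.1 p.2 := by
  refine measurable_pi_lambda _ fun i => ?_
  cases i with
  | zero => exact measurable_fst
  | succ i => exact (measurable_pi_apply i).comp measurable_snd

theorem map_seqCons_infinitePi (ν : Measure A) [IsProbabilityMeasure ν] :
    (ν.prod (infinitePi fun _ : ℕ => ν)).map (fun p => seqCons p.1 p.2) =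
      infinitePi fun _ : ℕ => ν := by
  classical
  refine eq_infinitePi _ fun s t ht => ?_
  obtain ⟨N, hN⟩ := s.exists_nat_subset_range
  replace hN : s ⊆ Finset.range (N + 1) := hN.trans (Finset.range_mono N.le_succ)
  let t' : ℕ → Set A := fun i => if i ∈ s then t i else Set.univ
  have ht' (i : ℕ) : MeasurableSet (t' i) := by
    by_cases hi : i ∈ s <;> simp [t', hi, ht]
  have box : (s : Set ℕ).pi t = Set.pi (Finset.range (N + 1)) t' := by
    ext w
    simp only [t', Set.mem_pi, SetLike.mem_coe]
    refine ⟨fun h i _ => ?_, fun h i hi => by simpa [hi] using h i (hN hi)⟩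
    split_ifs with hi
    exacts [h i hi, trivial]
  have weights : ∏ i ∈ s, ν (t i) = ∏ i ∈ Finset.range (N + 1), ν (t' i) := by
    rw [← Finset.prod_subset hN fun i _ hi => by simp [t', hi]]
    exact Finset.prod_congr rfl fun i hi => by simp [t', hi]
  rw [map_apply measurable_seqCons (.pi s.countable_toSet fun _ _ => ht _), box, weights,
    preimage_seqCons_pi_range, prod_prod, infinitePi_pi _ fun i _ => ht' _, mul_comm,
    ← Finset.prod_range_succ' (fun i => ν (t' i))]

theorem uniformOn_univ_singleton [Fintype A] [MeasurableSingletonClass A] (a : A) :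
    uniformOn (Set.univ : Set A) {a} = (Fintype.card A : ENNReal)⁻¹ := by
  rw [uniformOn_univ, count_singleton, one_div]

instance [Finite A] [Nonempty A] : IsProbabilityMeasure (symmetricProduct A) := by
  unfold symmetricProduct; infer_instance

theorem symmetricProduct_setOf_forall_eq [Fintype A] [Nonempty A] [MeasurableSingletonClass A]
    [Fintype κ] {f : κ → ℤ} (hf : Function.Injective f) (c : κ → A) :
    symmetricProduct A {a | ∀ k, a (f k) = c k} =
      ((Fintype.card A : ENNReal)⁻¹) ^ Fintype.card κ := by
  have preimage : {a : ℤ → A | ∀ k, a (f k) = c k} = (fun a k => a (f k)) ⁻¹' {c} := by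
    ext a
    simp [funext_iff]
  rw [preimage, ← map_apply (by fun_prop) (measurableSet_singleton c), symmetricProduct,
    map_comp_infinitePi _ hf, infinitePi_singleton_of_fintype]
  simp [uniformOn_univ_singleton]

end ProductMeasures

/-! ### The simple random walk -/

section RandomWalk

open ProbabilityTheory

/-- Independent fair coins, the steps of the simple random walk: `true` is a step up. -/
noncomputable def coinMeasure : Measure (ℕ → Bool) :=
  Measure.infinitePi fun _ => uniformOn Set.univ

instance : IsProbabilityMeasure coinMeasure := by unfold coinMeasure; infer_instance

theorem measurePreserving_seqCons_coinMeasure : MeasurePreserving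
    (fun p : Bool × (ℕ → Bool) => seqCons p.1 p.2)
    ((uniformOn (Set.univ : Set Bool)).prod coinMeasure) coinMeasure :=
  ⟨measurable_seqCons, map_seqCons_infinitePi _⟩

theorem integral_coinMeasure {f : (ℕ → Bool) → ℝ} (hf : Integrable f coinMeasure) :
    ∫ w, f w ∂coinMeasure = (1 / 2) * ∫ w, f (seqCons true w) ∂coinMeasure +
      (1 / 2) * ∫ w, f (seqCons false w) ∂coinMeasure := by
  have preserving := measurePreserving_seqCons_coinMeasure
  have integrable : Integrable (fun p : Bool × (ℕ → Bool) => f (seqCons p.1 p.2))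
      ((uniformOn (Set.univ : Set Bool)).prod coinMeasure) :=
    preserving.integrable_comp_of_integrable hf
  have := integral_map preserving.measurable.aemeasurable
    (preserving.map_eq.symm ▸ hf.aestronglyMeasurable)
  rw [preserving.map_eq] at this
  rw [this, integral_prod _ integrable, integral_fintype Integrable.of_finite]
  simp only [measureReal_def, uniformOn_univ_singleton, Fintype.sum_bool]
  simp

theorem measureReal_coinMeasure {B : Set (ℕ → Bool)} (hB : MeasurableSet B) :
    coinMeasure.real B = (1 / 2) * coinMeasure.real {w | seqCons true w ∈ B} +
      (1 / 2) * coinMeasure.real {w | seqCons false w ∈ B} := by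
  have hcons (b : Bool) : MeasurableSet {w : ℕ → Bool | seqCons b w ∈ B} :=
    (measurable_seqCons.comp measurable_prodMk_left) hB
  have key := integral_coinMeasure ((integrable_const (1 : ℝ)).indicator hB)
  rw [← Pi.one_def, integral_indicator_one hB] at key
  rw [key, ← integral_indicator_one (hcons true), ← integral_indicator_one (hcons false)]
  rfl

/-- The depth below its starting point which the walk reaches within `n` steps. -/
def walkDepth : ℕ → (ℕ → Bool) → ℕ
  | 0, _ => 0
  | n + 1, w => if w 0 then walkDepth n (fun i => w (i + 1)) - 1
      else walkDepth n (fun i => w (i + 1)) + 1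

/-- The number of up-steps among the first `n`. -/
def upCount : ℕ → (ℕ → Bool) → ℕ
  | 0, _ => 0
  | n + 1, w => if w 0 then upCount n (fun i => w (i + 1)) + 1
      else upCount n (fun i => w (i + 1))

@[simp] theorem walkDepth_zero (w : ℕ → Bool) : walkDepth 0 w = 0 := rfl

@[simp] theorem walkDepth_seqCons_true (n : ℕ) (w : ℕ → Bool) :
    walkDepth (n + 1) (seqCons true w) = walkDepth n w - 1 := rfl

@[simp] theorem walkDepth_seqCons_false (n : ℕ) (w : ℕ → Bool) :
    walkDepth (n + 1) (seqCons false w) = walkDepth n w + 1 := rfl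

@[simp] theorem upCount_zero (w : ℕ → Bool) : upCount 0 w = 0 := rfl

@[simp] theorem upCount_seqCons_true (n : ℕ) (w : ℕ → Bool) :
    upCount (n + 1) (seqCons true w) = upCount n w + 1 := rfl

@[simp] theorem upCount_seqCons_false (n : ℕ) (w : ℕ → Bool) :
    upCount (n + 1) (seqCons false w) = upCount n w := rfl

theorem walkDepth_le (n : ℕ) (w : ℕ → Bool) : walkDepth n w ≤ n := by
  induction n generalizing w with
  | zero => rfl
  | succ n ih =>
    have := ih fun i => w (i + 1)
    rw [walkDepth]
    split_ifs <;> omega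

theorem upCount_le (n : ℕ) (w : ℕ → Bool) : upCount n w ≤ n := by
  induction n generalizing w with
  | zero => rfl
  | succ n ih =>
    have := ih fun i => w (i + 1)
    rw [upCount]
    split_ifs <;> omega

theorem walkDepth_le_succ (n : ℕ) (w : ℕ → Bool) : walkDepth n w ≤ walkDepth (n + 1) w := by
  induction n generalizing w with
  | zero => simp
  | succ n ih =>
    have := ih fun i => w (i + 1)
    rw [walkDepth, walkDepth]
    split_ifs <;> omega

theorem measurable_walkDepth (n : ℕ) : Measurable (walkDepth n) := by
  induction n with
  | zero => exact measurable_const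
  | succ n ih =>
    have tail : Measurable fun w : ℕ → Bool => walkDepth n fun i => w (i + 1) :=
      ih.comp (by fun_prop)
    exact .ite (measurableSet_eq_fun (measurable_pi_apply 0) measurable_const)
      (tail.sub_const 1) (tail.add_const 1)

theorem measurable_upCount (n : ℕ) : Measurable (upCount n) := by
  induction n with
  | zero => exact measurable_const
  | succ n ih =>
    have tail : Measurable fun w : ℕ → Bool => upCount n fun i => w (i + 1) :=
      ih.comp (by fun_prop)
    exact .ite (measurableSet_eq_fun (measurable_pi_apply 0) measurable_const)
      (tail.add_const 1) tail

theorem integrable_natCast_of_le {Ω : Type*} [MeasurableSpace Ω] {μ : Measure Ω}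
    [IsFiniteMeasure μ] {f : Ω → ℕ} (hf : Measurable f) {n : ℕ} (h : ∀ x, f x ≤ n) :
    Integrable (fun x => (f x : ℝ)) μ :=
  .of_bound (C := n) (measurable_from_nat.comp hf).aestronglyMeasurable
    (ae_of_all _ fun x => by simpa using h x)

theorem integrable_walkDepth (n : ℕ) : Integrable (fun w => (walkDepth n w : ℝ)) coinMeasure :=
  integrable_natCast_of_le (measurable_walkDepth n) (walkDepth_le n)

theorem integrable_upCount (n : ℕ) : Integrable (fun w => (upCount n w : ℝ)) coinMeasure :=
  integrable_natCast_of_le (measurable_upCount n) (upCount_le n)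

theorem integral_upCount (n : ℕ) : ∫ w, (upCount n w : ℝ) ∂coinMeasure = n / 2 := by
  induction n with
  | zero => simp
  | succ n ih =>
    rw [integral_coinMeasure (integrable_upCount _)]
    simp only [upCount_seqCons_true, upCount_seqCons_false, Nat.cast_add, Nat.cast_one]
    rw [integral_add (integrable_upCount n) (integrable_const _), ih, integral_const,
      probReal_univ, one_smul]
    ring

/-- The walks which never go below `-K`. -/
def boundedWalks (K : ℕ) : Set (ℕ → Bool) := {w | ∀ n, walkDepth n w ≤ K}

theorem measurableSet_boundedWalks (K : ℕ) : MeasurableSet (boundedWalks K) := by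
  unfold boundedWalks
  rw [Set.ofPred_forall]
  exact .iInter fun n => measurableSet_le (measurable_walkDepth n) measurable_const

theorem seqCons_true_mem_boundedWalks {K : ℕ} {w : ℕ → Bool} :
    seqCons true w ∈ boundedWalks K ↔ w ∈ boundedWalks (K + 1) := by
  refine ⟨fun h n => by simpa using h (n + 1), fun h n => ?_⟩
  cases n with
  | zero => simp
  | succ n => simpa using h n

theorem seqCons_false_mem_boundedWalks_succ {K : ℕ} {w : ℕ → Bool} :
    seqCons false w ∈ boundedWalks (K + 1) ↔ w ∈ boundedWalks K := by
  refine ⟨fun h n => by simpa using h (n + 1), fun h n => ?_⟩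
  cases n with
  | zero => simp
  | succ n => simpa using h n

theorem seqCons_false_notMem_boundedWalks_zero (w : ℕ → Bool) :
    seqCons false w ∉ boundedWalks 0 := fun h => by
  simpa using h 1

theorem eq_zero_of_bounded_of_harmonic {q : ℕ → ℝ} {C : ℝ} (nonneg : ∀ K, 0 ≤ q K)
    (le : ∀ K, q K ≤ C) (zero : q 0 = 1 / 2 * q 1)
    (succ : ∀ K, q (K + 1) = 1 / 2 * q (K + 2) + 1 / 2 * q K) (K : ℕ) : q K = 0 := by
  have linear (K : ℕ) : q K = (K + 1) * q 0 ∧ q (K + 1) = (K + 2) * q 0 := by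
    induction K with
    | zero =>
      constructor <;> push_cast <;> linarith
    | succ K ih =>
      have := succ K
      push_cast
      constructor <;> linarith
  have h0 : q 0 = 0 := by
    by_contra hne
    have pos : 0 < q 0 := (nonneg 0).lt_of_ne' hne
    obtain ⟨n, hn⟩ := exists_nat_gt (C / q 0)
    have := le n
    rw [(linear n).1] at this
    rw [div_lt_iff₀ pos] at hn
    linarith
  rw [(linear K).1, h0, mul_zero]

theorem coinMeasure_boundedWalks (K : ℕ) : coinMeasure (boundedWalks K) = 0 := by
  refine (measureReal_eq_zero_iff).1 <|
    eq_zero_of_bounded_of_harmonic (q := fun K => coinMeasure.real (boundedWalks K))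
      (fun _ => measureReal_nonneg) (fun _ => measureReal_le_one) ?_ (fun K => ?_) K
  · rw [measureReal_coinMeasure (measurableSet_boundedWalks 0)]
    simp [seqCons_true_mem_boundedWalks, seqCons_false_notMem_boundedWalks_zero]
  · rw [measureReal_coinMeasure (measurableSet_boundedWalks (K + 1))]
    simp [seqCons_true_mem_boundedWalks, seqCons_false_mem_boundedWalks_succ]

theorem ae_exists_lt_walkDepth : ∀ᵐ w ∂coinMeasure, ∀ K : ℕ, ∃ n, K < walkDepth n w := by
  refine ae_all_iff.2 fun K => ?_
  rw [ae_iff]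
  convert coinMeasure_boundedWalks K using 2
  ext w
  simp [boundedWalks]

/-- A step up decreases the depth, except when the depth is `0`. -/
theorem integral_walkDepth_succ (n : ℕ) :
    ∫ w, (walkDepth (n + 1) w : ℝ) ∂coinMeasure = ∫ w, (walkDepth n w : ℝ) ∂coinMeasure +
      (1 / 2) * coinMeasure.real {w | walkDepth n w = 0} := by
  set Z : Set (ℕ → Bool) := {w | walkDepth n w = 0}
  have hZ : MeasurableSet Z := measurableSet_eq_fun (measurable_walkDepth n) measurable_const
  have pred (w : ℕ → Bool) : ((walkDepth n w - 1 : ℕ) : ℝ) =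
      (walkDepth n w : ℝ) - 1 + Z.indicator 1 w := by
    by_cases h : walkDepth n w = 0
    · simp [Set.indicator_of_mem (show w ∈ Z from h), h]
    · rw [Set.indicator_of_notMem (show w ∉ Z from h), Nat.cast_sub (by omega)]
      simp
  have hd := integrable_walkDepth n
  have hc : Integrable (fun _ => (1 : ℝ)) coinMeasure := integrable_const _
  have hi : Integrable (Z.indicator (1 : (ℕ → Bool) → ℝ)) coinMeasure := hc.indicator hZ
  rw [integral_coinMeasure (integrable_walkDepth _)]
  simp only [walkDepth_seqCons_true, walkDepth_seqCons_false, pred, Nat.cast_add, Nat.cast_one]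
  rw [integral_add (f := fun w => (walkDepth n w : ℝ) - 1) (hd.sub hc) hi, integral_sub hd hc,
    integral_add hd hc, integral_indicator_one hZ, integral_const, probReal_univ, one_smul]
  ring

theorem tendsto_coinMeasure_walkDepth_eq_zero :
    Tendsto (fun n => coinMeasure.real {w | walkDepth n w = 0}) atTop (nhds 0) := by
  have anti : Antitone fun n => {w | walkDepth n w = 0} :=
    antitone_nat_of_succ_le fun n w (hw : walkDepth (n + 1) w = 0) =>
      Nat.eq_zero_of_le_zero (hw ▸ walkDepth_le_succ n w)
  have lim := tendsto_measure_iInter_atTop (μ := coinMeasure)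
    (fun n => (measurableSet_eq_fun (measurable_walkDepth n)
      measurable_const).nullMeasurableSet) anti ⟨0, measure_ne_top _ _⟩
  have inter : (⋂ n, {w | walkDepth n w = 0}) = boundedWalks 0 := by
    ext w
    simp [boundedWalks]
  rw [inter, coinMeasure_boundedWalks] at lim
  exact (ENNReal.tendsto_toReal ENNReal.zero_ne_top).comp lim

theorem tendsto_integral_walkDepth_div :
    Tendsto (fun n : ℕ => (∫ w, (walkDepth n w : ℝ) ∂coinMeasure) / n) atTop (nhds 0) := by
  have average := (tendsto_coinMeasure_walkDepth_eq_zero.const_mul (1 / 2)).cesaro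
  rw [mul_zero] at average
  refine average.congr fun n => ?_
  rw [div_eq_inv_mul (∫ w, (walkDepth n w : ℝ) ∂coinMeasure)]
  congr 1
  clear average
  induction n with
  | zero => simp
  | succ n ih => rw [Finset.sum_range_succ, ih, integral_walkDepth_succ]

theorem exists_lt_of_lt_walkDepth {n : ℕ} {w : ℕ → Bool} {K : ℕ} {f : ℕ → ℤ}
    (hf : ∀ k, f (k + 1) = f k + if w k then 1 else -1) (h : K < walkDepth n w) :
    ∃ k, f k < f 0 - K := by
  induction n generalizing w K f with
  | zero => simp at h
  | succ n ih =>
    have first := hf 0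
    have ih {K} := ih (K := K) (f := fun k => f (k + 1)) fun k => hf (k + 1)
    rw [walkDepth] at h
    split_ifs at h with hw
    · obtain ⟨k, hk⟩ := ih (K := K + 1) (by omega)
      simp only [hw, if_true, zero_add] at first hk
      exact ⟨k + 1, by push_cast at hk; omega⟩
    · simp only [hw, zero_add] at first
      cases K with
      | zero => exact ⟨1, by simp at first ⊢; omega⟩
      | succ K =>
        obtain ⟨k, hk⟩ := ih (K := K) (by omega)
        simp only [zero_add] at hk
        exact ⟨k + 1, by simp at first; push_cast; omega⟩

theorem measurePreserving_right_steps (r : ℤ) : MeasurePreserving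
    (fun (z : ℤ → Bool) (i : ℕ) => z (r + i)) (symmetricProduct Bool) coinMeasure :=
  ⟨by fun_prop, map_comp_infinitePi _ fun i j h => by simpa using h⟩

theorem measurePreserving_not_coinMeasure :
    MeasurePreserving (fun (w : ℕ → Bool) i => !w i) coinMeasure coinMeasure := by
  refine ⟨measurable_pi_lambda _ fun i => (measurable_of_finite not).comp (measurable_pi_apply i),
    ?_⟩
  rw [coinMeasure, Measure.infinitePi_map_pi _ fun _ => measurable_of_finite _]
  congr 1
  funext _
  refine Measure.ext_of_singleton fun b => ?_
  rw [Measure.map_apply (measurable_of_finite _) (measurableSet_singleton b),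
    show (fun b => !b) ⁻¹' {b} = {!b} by ext c; cases b <;> cases c <;> simp,
    uniformOn_univ_singleton, uniformOn_univ_singleton]

/-- Read from right to left, the walk goes down where `z` goes up. -/
theorem measurePreserving_left_steps : MeasurePreserving
    (fun (z : ℤ → Bool) (i : ℕ) => !z (-1 - i)) (symmetricProduct Bool) coinMeasure :=
  measurePreserving_not_coinMeasure.comp
    ⟨by fun_prop,
      map_comp_infinitePi (f := fun i : ℕ => -1 - (i : ℤ)) _ fun i j h => by simpa using h⟩

theorem ae_mem_recurrentSet : ∀ᵐ z ∂symmetricProduct Bool, z ∈ recurrentSet := by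
  filter_upwards
    [(measurePreserving_right_steps 0).quasiMeasurePreserving.ae ae_exists_lt_walkDepth,
    measurePreserving_left_steps.quasiMeasurePreserving.ae ae_exists_lt_walkDepth] with z hr hl
  rw [mem_recurrentSet_iff]
  refine ⟨rightUnbounded_of_forall fun c => ?_, leftUnbounded_of_forall fun c => ?_⟩
  · obtain ⟨n, hn⟩ := hr c
    obtain ⟨k, hk⟩ := exists_lt_of_lt_walkDepth (f := fun k : ℕ => height z k)
      (fun k => by push_cast; rw [height_succ, zero_add]) hn
    exact ⟨k, by omega, by simpa using hk⟩
  · obtain ⟨n, hn⟩ := hl c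
    obtain ⟨k, hk⟩ := exists_lt_of_lt_walkDepth (f := fun k : ℕ => height z (-k)) (fun k => by
      have := height_succ z (-1 - k)
      rw [show (-1 - (k : ℤ)) + 1 = -k by ring] at this
      rw [this, show -((k + 1 : ℕ) : ℤ) = -1 - k by push_cast; ring]
      cases z (-1 - k) <;> simp) hn
    exact ⟨-k, by omega, by simpa using hk⟩

end RandomWalk

/-! ### Measurability -/

section Measurability

theorem measurable_height (i : ℤ) : Measurable fun z => height z i := by
  have step (j : ℤ) : Measurable fun z : ℤ → Bool => if z j then (1 : ℤ) else -1 :=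
    (measurable_of_finite fun b : Bool => if b then (1 : ℤ) else -1).comp (measurable_pi_apply j)
  exact (Finset.measurable_fun_sum _ fun j _ => step j).sub
    (Finset.measurable_fun_sum _ fun j _ => step j)

theorem measurable_onesIndex (k : ℤ) : Measurable fun z => onesIndex z k := by
  have step (j : ℤ) : Measurable fun z : ℤ → Bool => if z j then (1 : ℤ) else 0 :=
    (measurable_of_finite fun b : Bool => if b then (1 : ℤ) else 0).comp (measurable_pi_apply j)
  unfold onesIndex
  split_ifs
  · exact Finset.measurable_fun_sum _ fun j _ => step j
  · exact (Finset.measurable_fun_sum _ fun j _ => step j).neg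

theorem measurableSet_recurrentSet : MeasurableSet recurrentSet := by
  have height_le (l c : ℤ) : Measurable fun z => height z l ≤ c :=
    measurableSet_setOfPred.1 (measurableSet_le (measurable_height l) measurable_const)
  have unbounded : recurrentSet = {z | RightUnbounded z ∧ LeftUnbounded z} := by
    ext z
    exact mem_recurrentSet_iff
  rw [unbounded]
  refine measurableSet_setOfPred.2 (.and ?_ ?_) <;>
    exact .forall fun r => .forall fun c => .exists fun l => measurable_const.and (height_le l c)

theorem measurable_int_sSup {Ω : Type*} [MeasurableSpace Ω] {f : Ω → Set ℤ}
    (hf : ∀ l, MeasurableSet {w | l ∈ f w}) (hb : ∀ w, BddAbove (f w)) :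
    Measurable fun w => sSup (f w) := by
  refine measurable_to_countable' fun l => ?_
  have fiber : (fun w => sSup (f w)) ⁻¹' {l} =
      ({w | l ∈ f w} ∩ ⋂ l' ∈ Set.Ioi l, {w | l' ∈ f w}ᶜ) ∪
        ((⋂ l', {w | l' ∈ f w}ᶜ) ∩ {_w | l = 0}) := by
    ext w
    simp only [Set.mem_preimage, Set.mem_singleton_iff, Set.mem_union, Set.mem_inter_iff,
      Set.mem_ofPred_eq, Set.mem_iInter, Set.mem_compl_iff, Set.mem_Ioi]
    constructor
    · rintro rfl
      rcases (f w).eq_empty_or_nonempty with h | h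
      · right; simp [h]
      · exact Or.inl ⟨Int.csSup_mem h (hb w), fun l' hl' hmem =>
          absurd (le_csSup (hb w) hmem) (not_le.2 hl')⟩
    · rintro (⟨hl, greatest⟩ | ⟨empty, rfl⟩)
      · exact IsGreatest.csSup_eq ⟨hl, fun l' hl' => not_lt.1 fun h => greatest l' h hl'⟩
      · rw [Set.eq_empty_of_forall_notMem empty, Int.csSup_empty]
  rw [fiber]
  exact ((hf l).inter (.biInter (Set.to_countable _) fun l' _ => (hf l').compl)).union
    ((MeasurableSet.iInter fun l' => (hf l').compl).inter (.const _))

theorem measurable_openPos (r : ℤ) (i : ℕ) : Measurable fun z => openPos z r i := by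
  refine measurable_int_sSup (fun l => ?_) fun z => ⟨r, fun l hl => hl.1.le⟩
  exact (MeasurableSet.const _).inter (measurableSet_le (measurable_height l)
    (((measurable_height r).sub_const 1).sub_const _))

theorem measurable_matchIndex (n : ℤ) : Measurable fun z => matchIndex z n := by
  refine measurable_int_sSup (fun l => ?_) fun z => ⟨n, fun l hl => hl.1.le⟩
  exact (MeasurableSet.const _).inter (measurableSet_le (measurable_height l)
    (measurable_height _))

theorem measurable_apply_index {Ω A : Type*} [MeasurableSpace Ω] [MeasurableSpace A]
    {f : Ω → ℤ → A} {g : Ω → ℤ} (hf : ∀ k, Measurable fun w => f w k) (hg : Measurable g) :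
    Measurable fun w => f w (g w) :=
  (measurable_from_prod_countable_left (f := fun p : Ω × ℤ => f p.1 p.2) hf).comp
    (measurable_id.prodMk hg)

variable {m : ℕ}

theorem measurable_dyckF : Measurable (dyckF (m := m)) := by
  have label (k : ℤ) : Measurable fun p : (ℤ → Bool) × (ℤ → Fin m) => p.2 (onesIndex p.1 k) :=
    measurable_apply_index (f := fun p : (ℤ → Bool) × (ℤ → Fin m) => p.2)
      (fun k => (measurable_pi_apply k).comp measurable_snd)
      ((measurable_onesIndex k).comp measurable_fst)
  refine measurable_pi_lambda _ fun n => ?_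
  refine .ite (measurableSet_eq_fun ((measurable_pi_apply n).comp measurable_fst)
    measurable_const) ((measurable_of_finite DyckLetter.α).comp (label n)) ?_
  exact (measurable_of_finite DyckLetter.β).comp (measurable_apply_index
    (f := fun (p : (ℤ → Bool) × (ℤ → Fin m)) k => p.2 (onesIndex p.1 k)) label
    ((measurable_matchIndex n).comp measurable_fst))

theorem measurable_openPattern : Measurable (openPattern (m := m)) :=
  measurable_pi_lambda _ fun n => (measurable_of_finite DyckLetter.isOpening).comp
    (measurable_pi_apply n)

theorem measurable_openStack (r : ℤ) (i : ℕ) :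
    Measurable fun x : ℤ → DyckLetter m => openStack x r i :=
  measurable_apply_index (f := fun (x : ℤ → DyckLetter m) k => (x k).label)
    (fun k => (measurable_of_finite DyckLetter.label).comp (measurable_pi_apply k))
    ((measurable_openPos r i).comp measurable_openPattern)

end Measurability

section CylinderSets

variable {A : Type*}

/-- The cylinder of the sequences which agree with `y` on `[r, r + n)`. -/
def cylSet (y : ℤ → A) (r : ℤ) (n : ℕ) : Set (ℤ → A) :=
  {x | blockList x r n = blockList y r n}

theorem mem_cylSet {x y : ℤ → A} {r : ℤ} {n : ℕ} :
    x ∈ cylSet y r n ↔ blockList x r n = blockList y r n := Iff.rfl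

theorem restrict_preimage_singleton (y : ℤ → A) (r : ℤ) (n : ℕ) :
    (Finset.Ico r (r + n)).restrict (π := fun _ => A) ⁻¹'
      {(Finset.Ico r (r + n)).restrict y} = cylSet y r n := by
  ext x
  simp [mem_cylSet, blockList_eq_iff, funext_iff]

variable [MeasurableSpace A] [DiscreteMeasurableSpace A]

theorem measurableSet_blockList_eq (r : ℤ) (n : ℕ) (w : List A) :
    MeasurableSet {x : ℤ → A | blockList x r n = w} := by
  induction n generalizing r w with
  | zero => simp only [blockList_zero, MeasurableSet.const]
  | succ n ih =>
    cases w with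
    | nil => simp [blockList_succ]
    | cons a w =>
      simp only [blockList_succ, List.cons.injEq]
      exact (measurable_pi_apply (X := fun _ : ℤ => A) r (.of_discrete (s := {a}))).inter
        (ih (r + 1) w)

theorem measurableSet_cylSet (y : ℤ → A) (r : ℤ) (n : ℕ) : MeasurableSet (cylSet y r n) :=
  measurableSet_blockList_eq r n _

theorem measurable_blockList_comp [Countable A] {B : Type*} [MeasurableSpace B] (r : ℤ) (n : ℕ)
    (f : List A → B) : Measurable fun x : ℤ → A => f (blockList x r n) := by
  let _ : MeasurableSpace (List A) := ⊤
  exact (measurable_from_top (f := f)).comp <|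
    measurable_to_countable' fun w => measurableSet_blockList_eq r n w

theorem measurableSet_dyckShift {m : ℕ} : MeasurableSet (dyckShift m) := by
  have inter : dyckShift m = ⋂ (r : ℤ) (n : ℕ), {x | block x r n ∈ dyckLanguage m} := by
    ext x
    simp [dyckShift]
  rw [inter]
  refine .iInter fun r => .iInter fun n => measurableSet_setOfPred.2 ?_
  simpa only [← toList_block, FreeMonoid.ofList_toList] using
    measurable_blockList_comp r n fun w => FreeMonoid.ofList w ∈ dyckLanguage m

variable [Finite A] [Nonempty A] {μ ν : Measure (ℤ → A)}

theorem map_restrict_Ico_eq {r : ℤ} {n : ℕ}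
    (h : ∀ y, μ (cylSet y r n) = ν (cylSet y r n)) :
    μ.map (Finset.Ico r (r + n)).restrict = ν.map (Finset.Ico r (r + n)).restrict := by
  refine Measure.ext_of_singleton fun w => ?_
  obtain ⟨y, rfl⟩ : ∃ y : ℤ → A, (Finset.Ico r (r + n)).restrict y = w :=
    ⟨Function.extend Subtype.val w fun _ => Classical.arbitrary A,
      funext fun k => Subtype.val_injective.extend_apply _ _ k⟩
  rw [Measure.map_apply (by fun_prop) (measurableSet_singleton _),
    Measure.map_apply (by fun_prop) (measurableSet_singleton _), restrict_preimage_singleton, h]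

theorem ext_of_cylSet [IsFiniteMeasure ν] (N : ℕ)
    (h : ∀ M ≥ N, ∀ y, μ (cylSet y (-M) (2 * M + 1)) = ν (cylSet y (-M) (2 * M + 1))) :
    μ = ν := by
  have marginals : IsProjectiveLimit μ fun I : Finset ℤ => ν.map I.restrict := by
    intro I
    obtain ⟨M, hM, hI⟩ : ∃ M ≥ N, I ⊆ Finset.Ico (-M : ℤ) (-M + (2 * M + 1 : ℕ)) := by
      refine ⟨N + I.sup Int.natAbs, by omega, fun k hk => Finset.mem_Ico.2 ?_⟩
      have : k.natAbs ≤ I.sup Int.natAbs := Finset.le_sup hk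
      omega
    have restrict : (I.restrict : (ℤ → A) → (I → A)) =
        Finset.restrict₂ hI ∘ (Finset.Ico _ _).restrict := rfl
    dsimp only
    rw [restrict, ← Measure.map_map (by fun_prop) (by fun_prop), map_restrict_Ico_eq (h M hM),
      Measure.map_map (by fun_prop) (by fun_prop)]
  exact marginals.unique fun I => rfl

end CylinderSets

theorem symmetricProduct_cylSet {A : Type*} [MeasurableSpace A] [DiscreteMeasurableSpace A]
    [Fintype A] [Nonempty A] (y : ℤ → A) (r : ℤ) (n : ℕ) :
    symmetricProduct A (cylSet y r n) = (Fintype.card A : ENNReal)⁻¹ ^ n := by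
  have box : cylSet y r n = {x | ∀ k : Fin n, x (r + k) = y (r + k)} := by
    ext x
    rw [mem_cylSet, blockList_eq_iff]
    refine ⟨fun h k => h _ (by omega) (by omega), fun h k hk hk' => ?_⟩
    obtain ⟨i, rfl⟩ := Int.le.dest hk
    exact h ⟨i, by omega⟩
  rw [box, symmetricProduct_setOf_forall_eq (f := fun k : Fin n => r + ((k : ℕ) : ℤ))
    (fun i j h => Fin.ext (by simpa using h)), Fintype.card_fin]

/-! ### The mass of cylinders -/

section CylinderMass

variable {m : ℕ}

theorem card_eq_upCount (n : ℕ) (w : ℕ → Bool) :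
    Fintype.card {k : Fin n // w k = true} = upCount n w := by
  rw [Fintype.card_subtype, Finset.card_filter]
  induction n generalizing w with
  | zero => simp
  | succ n ih =>
    rw [Fin.sum_univ_succ, upCount]
    have := ih fun i => w (i + 1)
    simp only [Fin.val_zero, Fin.val_succ, this]
    by_cases h : w 0 = true <;> simp [h, Nat.add_comm]

theorem countP_blockList {A : Type*} (p : A → Bool) (x : ℤ → A) (r : ℤ) (n : ℕ) :
    (blockList x r n).countP p = upCount n fun i => p (x (r + i)) := by
  induction n generalizing r with
  | zero => rfl
  | succ n ih =>
    have tail (i : ℕ) : r + (i + 1 : ℕ) = r + 1 + i := by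
      push_cast
      ring
    simp only [blockList_succ, List.countP_cons, ih, upCount, tail, Nat.cast_zero, add_zero]
    split_ifs <;> rfl

/-- The indices of the labels which decide whether `dyckF (z, a)` has a given block on
`[r, r + n)` with `d` unmatched closing brackets: they belong to the opening brackets in the block
and to the `d` last brackets left open before it. -/
noncomputable def labelIndex (z : ℤ → Bool) (r : ℤ) (n d : ℕ) :
    {k : Fin n // z (r + (k : ℕ)) = true} ⊕ Fin d → ℤ :=
  Sum.elim (fun k => onesIndex z (r + (k : Fin n))) fun i => onesIndex z (openPos z r i)

theorem labelIndex_injective {z : ℤ → Bool} (hz : LeftUnbounded z) (r : ℤ) (n d : ℕ) :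
    Function.Injective (labelIndex z r n d) := by
  have before (i : ℕ) (k : Fin n) : openPos z r i ≠ r + (k : ℕ) := by
    have := openPos_lt hz r i
    omega
  refine Function.Injective.sumElim (fun k k' h => ?_) (fun i i' h => ?_) fun k i h => ?_
  · have := (strictMonoOn_onesIndex z).injOn k.2 k'.2 h
    exact Subtype.ext (Fin.ext (by simpa using this))
  · exact Fin.ext (openPos_injective hz r
      ((strictMonoOn_onesIndex z).injOn (apply_openPos hz r i) (apply_openPos hz r i') h))
  · exact before i k ((strictMonoOn_onesIndex z).injOn k.2 (apply_openPos hz r i) h).symm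

theorem dyckF_mem_cylSet_iff {z : ℤ → Bool} (hz : LeftUnbounded z) (a : ℤ → Fin m)
    (y : ℤ → DyckLetter m) (r : ℤ) (n : ℕ) :
    dyckF (z, a) ∈ cylSet y r n ↔ z ∈ cylSet (openPattern y) r n ∧
      (∀ k, r ≤ k → k < r + n → openPattern y k = true → a (onesIndex z k) = (y k).label) ∧
      stackRun (blockList y r n) (fun i => a (onesIndex z (openPos z r i))) ≠ none := by
  rw [mem_cylSet, dyckF_eq_bracketSeq, blockList_eq_iff_of_isMatched
    (by rwa [openPattern_bracketSeq]) (isMatched_bracketSeq hz _), openPattern_bracketSeq,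
    mem_cylSet, blockList_eq_iff]
  refine and_congr_right fun hzy => and_congr ?_ ?_
  · refine forall₄_congr fun k hk hk' ho => ?_
    rw [bracketSeq_of_true ((hzy k hk hk').trans ho), DyckLetter.label]
  · rw [show openStack _ r = _ from funext (openStack_bracketSeq hz _ r)]

theorem exists_dyckF_mem_cylSet_iff {z : ℤ → Bool} (hz : LeftUnbounded z)
    {y : ℤ → DyckLetter m} {r : ℤ} {n : ℕ} (hy : ∃ s, stackRun (blockList y r n) s ≠ none)
    (hzy : z ∈ cylSet (openPattern y) r n) : ∃ c : _ → Fin m, ∀ a, dyckF (z, a) ∈ cylSet y r n ↔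
      ∀ k, a (labelIndex z r n (unmatchedCount (blockList y r n)) k) = c k := by
  obtain ⟨s, hs⟩ := hy
  refine ⟨Sum.elim (fun k => (y (r + (k : Fin n))).label) fun i => s i, fun a => ?_⟩
  have pattern := blockList_eq_iff.1 (mem_cylSet.1 hzy)
  rw [dyckF_mem_cylSet_iff hz, stackRun_ne_none_iff hs, Sum.forall]
  simp only [hzy, true_and, labelIndex, Sum.elim_inl, Sum.elim_inr]
  refine and_congr ⟨fun h k => ?_, fun h k hk hk' ho => ?_⟩
    ⟨fun h i => h i i.2, fun h i hi => h ⟨i, hi⟩⟩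
  · have hk : r + (k : Fin n) < r + n := by omega
    exact h _ (by omega) hk ((pattern _ (by omega) hk).symm.trans k.2)
  · obtain ⟨i, rfl⟩ := Int.le.dest hk
    exact h ⟨⟨i, by omega⟩, (pattern _ hk hk').trans ho⟩

open Classical in
/-- The probability that independent uniform labels turn a bi-infinite sequence of brackets with
the pattern of `w` on some interval into one which reads `w` there. -/
noncomputable def labelWeight (w : List (DyckLetter m)) : ENNReal :=
  if ∃ s, stackRun w s ≠ none then
    (m : ENNReal)⁻¹ ^ (w.countP DyckLetter.isOpening + unmatchedCount w) else 0

theorem symmetricProduct_dyckF_mem_cylSet [NeZero m] {z : ℤ → Bool} (hz : LeftUnbounded z)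
    (y : ℤ → DyckLetter m) (r : ℤ) (n : ℕ) :
    symmetricProduct (Fin m) {a | dyckF (z, a) ∈ cylSet y r n} =
      (cylSet (openPattern y) r n).indicator (fun _ => labelWeight (blockList y r n)) z := by
  by_cases hzy : z ∈ cylSet (openPattern y) r n
  swap
  · simp [dyckF_mem_cylSet_iff hz, hzy]
  rw [Set.indicator_of_mem hzy, labelWeight]
  split_ifs with hy
  · obtain ⟨c, hc⟩ := exists_dyckF_mem_cylSet_iff hz hy hzy
    have openings : upCount n (fun i => z (r + i)) =
        upCount n fun i => (y (r + i)).isOpening := by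
      have := congrArg (List.countP id) (mem_cylSet.1 hzy)
      rwa [countP_blockList, countP_blockList] at this
    simp only [hc]
    rw [symmetricProduct_setOf_forall_eq (labelIndex_injective hz r n _), Fintype.card_sum,
      card_eq_upCount n fun i => z (r + i), openings,
      ← countP_blockList, Fintype.card_fin, Fintype.card_fin]
  · push Not at hy
    simp [dyckF_mem_cylSet_iff hz, hy]

theorem muFull_eq_map :
    muFull m = ((symmetricProduct Bool).prod (symmetricProduct (Fin m))).map dyckF := by
  rw [muFull, Measure.restrict_eq_self_of_ae_mem]
  filter_upwards [Measure.quasiMeasurePreserving_fst.ae ae_mem_recurrentSet] with p hp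
  exact ⟨hp, trivial⟩

instance [NeZero m] : IsProbabilityMeasure (muFull m) := by
  rw [muFull_eq_map]
  exact Measure.isProbabilityMeasure_map measurable_dyckF.aemeasurable

theorem muFull_cylSet [NeZero m] (y : ℤ → DyckLetter m) (r : ℤ) (n : ℕ) :
    muFull m (cylSet y r n) = (2 : ENNReal)⁻¹ ^ n * labelWeight (blockList y r n) := by
  rw [muFull_eq_map, Measure.map_apply measurable_dyckF (measurableSet_cylSet y r n),
    Measure.prod_apply (measurable_dyckF (measurableSet_cylSet y r n))]
  have fibers : ∀ᵐ z ∂symmetricProduct Bool,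
      symmetricProduct (Fin m) (Prod.mk z ⁻¹' (dyckF ⁻¹' cylSet y r n)) =
        (cylSet (openPattern y) r n).indicator (fun _ => labelWeight (blockList y r n)) z := by
    filter_upwards [ae_mem_recurrentSet] with z hz
    exact symmetricProduct_dyckF_mem_cylSet (mem_recurrentSet_iff.1 hz).2 y r n
  rw [lintegral_congr_ae fibers, lintegral_indicator_const (measurableSet_cylSet _ r n),
    symmetricProduct_cylSet, mul_comm, Fintype.card_bool, Nat.cast_ofNat]

theorem ae_muFull_iff [NeZero m] {p : (ℤ → DyckLetter m) → Prop} (hp : MeasurableSet {x | p x}) :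
    (∀ᵐ x ∂muFull m, p x) ↔
      ∀ᵐ z ∂symmetricProduct Bool, ∀ᵐ a ∂symmetricProduct (Fin m), p (dyckF (z, a)) := by
  rw [muFull_eq_map, ae_map_iff measurable_dyckF.aemeasurable hp]
  exact Measure.ae_prod_iff_ae_ae (measurable_dyckF hp)

theorem ae_mem_dyckShift [NeZero m] : ∀ᵐ x ∂muFull m, x ∈ dyckShift m := by
  refine (ae_muFull_iff measurableSet_dyckShift).2 ?_
  filter_upwards [ae_mem_recurrentSet] with z hz
  exact .of_forall fun _ => bracketSeq_mem_dyckShift (mem_recurrentSet_iff.1 hz).2 _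

theorem blockList_shift {A : Type*} (x : ℤ → A) (r : ℤ) (n : ℕ) :
    blockList (fun k => x (k + 1)) r n = blockList x (r + 1) n :=
  List.map_congr_left fun i _ => congrArg x (by ring)

theorem measurePreserving_shift_muFull [NeZero m] :
    MeasurePreserving (fun (x : ℤ → DyckLetter m) n => x (n + 1)) (muFull m) (muFull m) := by
  have hm : Measurable fun (x : ℤ → DyckLetter m) (n : ℤ) => x (n + 1) := by fun_prop
  have := Measure.isProbabilityMeasure_map (μ := muFull m) hm.aemeasurable
  refine ⟨hm, ext_of_cylSet 0 fun M _ y => ?_⟩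
  obtain ⟨y, rfl⟩ : ∃ y' : ℤ → DyckLetter m, y = fun k => y' (k + 1) :=
    ⟨fun k => y (k - 1), by simp⟩
  have preimage : (fun (x : ℤ → DyckLetter m) (n : ℤ) => x (n + 1)) ⁻¹'
      cylSet (fun k => y (k + 1)) (-M) (2 * M + 1) = cylSet y (-M + 1) (2 * M + 1) := by
    ext x
    simp only [Set.mem_preimage, mem_cylSet, blockList_shift]
  rw [Measure.map_apply hm (measurableSet_cylSet _ _ _), preimage, muFull_cylSet, muFull_cylSet,
    blockList_shift]

theorem measurableEmbedding_val :
    MeasurableEmbedding (Subtype.val : dyckShift m → ℤ → DyckLetter m) :=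
  .subtype_coe measurableSet_dyckShift

theorem muTilde_apply (B : Set (dyckShift m)) : muTilde m B = muFull m (Subtype.val '' B) :=
  measurableEmbedding_val.comap_apply _ _

theorem map_val_muTilde [NeZero m] : (muTilde m).map Subtype.val = muFull m := by
  rw [muTilde, measurableEmbedding_val.map_comap, Subtype.range_coe,
    Measure.restrict_eq_self_of_ae_mem ae_mem_dyckShift]

instance [NeZero m] : IsProbabilityMeasure (muTilde m) := by
  constructor
  have := congrArg (fun μ => μ Set.univ) (map_val_muTilde (m := m))
  simpa [Measure.map_apply measurable_subtype_coe] using this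

theorem measurePreserving_dyckT [NeZero m] :
    MeasurePreserving (dyckT m) (muTilde m) (muTilde m) := by
  have hT : Measurable (dyckT m) := measurableEmbedding_val.measurable_comp_iff.1 <|
    measurePreserving_shift_muFull.measurable.comp measurable_subtype_coe
  refine ⟨hT, ?_⟩
  have semiconj : (Subtype.val ∘ dyckT m : dyckShift m → ℤ → DyckLetter m) =
      (fun x n => x (n + 1)) ∘ Subtype.val := rfl
  rw [← measurableEmbedding_val.comap_map ((muTilde m).map (dyckT m)),
    Measure.map_map measurable_subtype_coe hT, semiconj,
    ← Measure.map_map (by fun_prop) measurable_subtype_coe, map_val_muTilde,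
    measurePreserving_shift_muFull.map_eq, muTilde]

end CylinderMass

/-! ### Words acting alike on stacks -/

section SameAction

variable {m : ℕ}

/-- The words act in the same way on stacks and have as many opening brackets as each other; by
`SameAction.muFull_cylSet_eq` their cylinders then have the same mass. -/
def SameAction (u v : List (DyckLetter m)) : Prop :=
  (∀ s, stackRun u s = stackRun v s) ∧
    u.countP DyckLetter.isOpening = v.countP DyckLetter.isOpening

theorem SameAction.symm {u v : List (DyckLetter m)} (h : SameAction u v) : SameAction v u :=
  ⟨fun s => (h.1 s).symm, h.2.symm⟩

theorem SameAction.append {u v : List (DyckLetter m)} (h : SameAction u v)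
    (p q : List (DyckLetter m)) : SameAction (p ++ (u ++ q)) (p ++ (v ++ q)) :=
  ⟨fun s => by simp only [stackRun_append, h.1], by simp only [List.countP_append, h.2]⟩

variable [Nontrivial (Fin m)]

theorem SameAction.labelWeight_eq {u v : List (DyckLetter m)} (h : SameAction u v) :
    labelWeight u = labelWeight v := by
  have admissible : (∃ s, stackRun u s ≠ none) ↔ ∃ s, stackRun v s ≠ none := by simp only [h.1]
  unfold labelWeight
  split_ifs with hu hv hv
  · obtain ⟨s, hs⟩ := hu
    rw [h.2, unmatchedCount_eq_of_stackRun_eq h.1 hs]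
  · exact absurd (admissible.1 hu) hv
  · exact absurd (admissible.2 hv) hu
  · rfl

variable [NeZero m]

theorem SameAction.muFull_cylSet_eq {y y' : ℤ → DyckLetter m} {r : ℤ} {n : ℕ}
    (h : SameAction (blockList y r n) (blockList y' r n)) :
    muFull m (cylSet y r n) = muFull m (cylSet y' r n) := by
  rw [muFull_cylSet, muFull_cylSet, h.labelWeight_eq]

end SameAction

section ReplaceBlock

variable {A : Type*} {x y y' v : ℤ → A} {r R : ℤ} {n L : ℕ}

/-- The sequence `x` with its block on `[r, r + n)` replaced by that of `y`. -/
def replaceBlock (y : ℤ → A) (r : ℤ) (n : ℕ) (x : ℤ → A) (k : ℤ) : A :=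
  if r ≤ k ∧ k < r + n then y k else x k

theorem measurable_replaceBlock [MeasurableSpace A] (y : ℤ → A) (r : ℤ) (n : ℕ) :
    Measurable (replaceBlock y r n) := by
  refine measurable_pi_lambda _ fun k => ?_
  unfold replaceBlock
  split_ifs <;> fun_prop

theorem mem_cylSet_iff_forall : x ∈ cylSet y r n ↔ ∀ k, r ≤ k → k < r + n → x k = y k :=
  mem_cylSet.trans blockList_eq_iff

theorem mem_cylSet_congr (hxv : x ∈ cylSet v R L) (hr : R ≤ r) (hn : r + n ≤ R + L) :
    x ∈ cylSet y r n ↔ v ∈ cylSet y r n := by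
  rw [mem_cylSet_iff_forall] at hxv
  rw [mem_cylSet_iff_forall, mem_cylSet_iff_forall]
  refine forall₃_congr fun k hk hk' => ?_
  rw [hxv k (hr.trans hk) (hk'.trans_le hn)]

theorem replaceBlock_mem_cylSet (y x : ℤ → A) (r : ℤ) (n : ℕ) :
    replaceBlock y r n x ∈ cylSet y r n :=
  mem_cylSet_iff_forall.2 fun _ hk hk' => if_pos ⟨hk, hk'⟩

theorem blockList_replaceBlock_of_disjoint (h : R + L ≤ r ∨ r + n ≤ R) :
    blockList (replaceBlock y r n x) R L = blockList x R L :=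
  blockList_eq_iff.2 fun _ _ _ => if_neg (by omega)

theorem replaceBlock_replaceBlock (hx : x ∈ cylSet y r n) :
    replaceBlock y r n (replaceBlock y' r n x) = x := by
  rw [mem_cylSet_iff_forall] at hx
  funext k
  unfold replaceBlock
  split_ifs with hk
  · exact (hx k hk.1 hk.2).symm
  · rfl

theorem replaceBlock_mem_cylSet_replaceBlock (hx : x ∈ cylSet v R L) :
    replaceBlock y r n x ∈ cylSet (replaceBlock y r n v) R L := by
  rw [mem_cylSet_iff_forall] at *
  intro k hk hk'
  unfold replaceBlock
  rw [hx k hk hk']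

theorem preimage_replaceBlock_cylSet_inter (hv : v ∈ cylSet y' r n) (hr : R ≤ r)
    (hn : r + n ≤ R + L) :
    replaceBlock y' r n ⁻¹' cylSet v R L ∩ cylSet y r n = cylSet (replaceBlock y r n v) R L := by
  ext x
  constructor
  · rintro ⟨hxv, hx⟩
    rw [← replaceBlock_replaceBlock (y' := y') hx]
    exact replaceBlock_mem_cylSet_replaceBlock hxv
  · intro hx
    refine ⟨?_, (mem_cylSet_congr hx hr hn).2 (replaceBlock_mem_cylSet y v r n)⟩
    rw [Set.mem_preimage, ← replaceBlock_replaceBlock (y' := y) hv]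
    exact replaceBlock_mem_cylSet_replaceBlock hx

theorem preimage_replaceBlock_cylSet_of_notMem (hv : v ∉ cylSet y' r n) (hr : R ≤ r)
    (hn : r + n ≤ R + L) : replaceBlock y' r n ⁻¹' cylSet v R L = ∅ :=
  Set.eq_empty_of_forall_notMem fun x hx =>
    hv ((mem_cylSet_congr hx hr hn).1 (replaceBlock_mem_cylSet y' x r n))

theorem image_replaceBlock {D : Set (ℤ → A)} (hD : D ⊆ cylSet y r n) :
    replaceBlock y' r n '' D = replaceBlock y r n ⁻¹' D ∩ cylSet y' r n := by
  ext x
  constructor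
  · rintro ⟨x, hx, rfl⟩
    refine ⟨?_, replaceBlock_mem_cylSet y' x r n⟩
    rwa [Set.mem_preimage, replaceBlock_replaceBlock (hD hx)]
  · exact fun hx => ⟨_, hx.1, replaceBlock_replaceBlock hx.2⟩

theorem blockList_centred (x : ℤ → A) {M N : ℕ} (h : N ≤ M) :
    blockList x (-M) (2 * M + 1) = blockList x (-M) (M - N) ++
      (blockList x (-N) (2 * N + 1) ++ blockList x (N + 1) (M - N)) := by
  rw [show 2 * M + 1 = (M - N) + ((2 * N + 1) + (M - N)) by omega, blockList_add, blockList_add,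
    show (-M : ℤ) + (M - N : ℕ) = -N by omega, show (-N : ℤ) + (2 * N + 1 : ℕ) = N + 1 by omega]

end ReplaceBlock

section Exchange

variable {m : ℕ} [NeZero m] [Nontrivial (Fin m)] {y y' : ℤ → DyckLetter m} {N : ℕ}

theorem map_replaceBlock_muFull
    (h : SameAction (blockList y (-N) (2 * N + 1)) (blockList y' (-N) (2 * N + 1))) :
    ((muFull m).restrict (cylSet y (-N) (2 * N + 1))).map (replaceBlock y' (-N) (2 * N + 1)) =
      (muFull m).restrict (cylSet y' (-N) (2 * N + 1)) := by
  refine ext_of_cylSet N fun M hM v => ?_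
  have left_le : (-M : ℤ) ≤ -N := by omega
  have right_le : (-N : ℤ) + (2 * N + 1 : ℕ) ≤ -M + (2 * M + 1 : ℕ) := by omega
  have measurable_cyl := measurableSet_cylSet v (-M) (2 * M + 1)
  have measurable_replace := measurable_replaceBlock y' (-N) (2 * N + 1)
  rw [Measure.map_apply measurable_replace measurable_cyl,
    Measure.restrict_apply (measurable_replace measurable_cyl),
    Measure.restrict_apply measurable_cyl]
  by_cases hv : v ∈ cylSet y' (-N) (2 * N + 1)
  · rw [preimage_replaceBlock_cylSet_inter hv left_le right_le,
      Set.inter_eq_left.2 fun x hx => (mem_cylSet_congr hx left_le right_le).2 hv]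
    refine SameAction.muFull_cylSet_eq ?_
    rw [blockList_centred _ hM, blockList_centred v hM, mem_cylSet.1 hv,
      mem_cylSet.1 (replaceBlock_mem_cylSet y v (-N) (2 * N + 1)),
      blockList_replaceBlock_of_disjoint (.inl (by omega)),
      blockList_replaceBlock_of_disjoint (.inr (by push_cast; omega))]
    exact h.append _ _
  · have disjoint : cylSet v (-M) (2 * M + 1) ∩ cylSet y' (-N) (2 * N + 1) = ∅ :=
      Set.eq_empty_of_forall_notMem fun x hx =>
        hv ((mem_cylSet_congr hx.1 left_le right_le).1 hx.2)
    rw [preimage_replaceBlock_cylSet_of_notMem hv left_le right_le, Set.empty_inter, disjoint]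

theorem muFull_image_replaceBlock
    (h : SameAction (blockList y (-N) (2 * N + 1)) (blockList y' (-N) (2 * N + 1)))
    {D : Set (ℤ → DyckLetter m)} (hD : MeasurableSet D)
    (hDy : D ⊆ cylSet y (-N) (2 * N + 1)) :
    muFull m (replaceBlock y' (-N) (2 * N + 1) '' D) = muFull m D := by
  rw [image_replaceBlock hDy, ← Measure.restrict_apply (measurable_replaceBlock _ _ _ hD),
    ← Measure.map_apply (measurable_replaceBlock _ _ _) hD, map_replaceBlock_muFull h.symm,
    Measure.restrict_apply hD, Set.inter_eq_left.2 hDy]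

end Exchange

/-! ### Generic points -/

section Generic

/-- The sequence is periodic from some index on. -/
def EventuallyPeriodic {A : Type*} (s : ℕ → A) : Prop := ∃ d > 0, ∃ i₀, ∀ i ≥ i₀, s (i + d) = s i

theorem measure_forall_apply_eq_eq_zero {A : Type*} [Finite A] [Nontrivial A] [MeasurableSpace A]
    [MeasurableSingletonClass A] {f : ℕ → ℤ} (hf : Function.Injective f) (c : A) :
    symmetricProduct A {a | ∀ k, a (f k) = c} = 0 := by
  cases nonempty_fintype A
  have le_pow (K : ℕ) :
      symmetricProduct A {a | ∀ k, a (f k) = c} ≤ (Fintype.card A : ENNReal)⁻¹ ^ K := by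
    have := symmetricProduct_setOf_forall_eq (hf.comp (Fin.val_injective (n := K))) fun _ => c
    rw [Fintype.card_fin] at this
    exact this ▸ measure_mono fun a ha k => ha k
  have card_inv_lt_one : (Fintype.card A : ENNReal)⁻¹ < 1 :=
    ENNReal.inv_lt_one.2 (mod_cast Fintype.one_lt_card)
  exact nonpos_iff_eq_zero.1 <|
    ge_of_tendsto' (ENNReal.tendsto_pow_atTop_nhds_zero_of_lt_one card_inv_lt_one) le_pow

theorem ae_not_eventuallyPeriodic {A : Type*} [Finite A] [Nontrivial A] [MeasurableSpace A]
    [MeasurableSingletonClass A] {f : ℕ → ℤ} (hf : Function.Injective f) :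
    ∀ᵐ a ∂symmetricProduct A, ¬ EventuallyPeriodic fun i => a (f i) := by
  simp only [EventuallyPeriodic, not_exists, not_and, ae_all_iff, eventually_imp_distrib_left]
  intro d hd i₀
  have subset : {a : ℤ → A | ∀ i ≥ i₀, a (f (i + d)) = a (f i)} ⊆
      ⋃ c : A, {a | ∀ k : ℕ, a (f (i₀ + k * d)) = c} := by
    refine fun a ha => Set.mem_iUnion.2 ⟨a (f i₀), fun k => ?_⟩
    induction k with
    | zero => simp
    | succ k ih => rw [add_one_mul, ← add_assoc, ha _ (Nat.le_add_right _ _), ih]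
  have injective : Function.Injective fun k : ℕ => f (i₀ + k * d) := fun k k' h =>
    Nat.eq_of_mul_eq_mul_right hd (Nat.add_left_cancel (hf h))
  refine ae_iff.2 ?_
  simp only [not_not]
  exact measure_mono_null subset
    (measure_iUnion_null fun c => measure_forall_apply_eq_eq_zero injective c)

variable {m : ℕ}

/-- The points for which the double-tail relation is governed by `SameAction`
(`exists_tailEquiv`): the height is unbounded below in both directions, and no stack of open
brackets is eventually periodic. -/
def IsGeneric (x : ℤ → DyckLetter m) : Prop :=
  openPattern x ∈ recurrentSet ∧ ∀ r, ¬ EventuallyPeriodic (openStack x r)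

theorem measurableSet_isGeneric : MeasurableSet {x : ℤ → DyckLetter m | IsGeneric x} := by
  have periodic (r : ℤ) :
      MeasurableSet {x : ℤ → DyckLetter m | EventuallyPeriodic (openStack x r)} :=
    measurableSet_setOfPred.2 <| .exists fun d => measurable_const.and <| .exists fun i₀ =>
      .forall fun i => measurable_const.imp <| measurableSet_setOfPred.1 <|
        measurableSet_eq_fun (measurable_openStack r (i + d)) (measurable_openStack r i)
  refine (measurable_openPattern measurableSet_recurrentSet).inter ?_
  exact measurableSet_setOfPred.2 <| .forall fun r =>
    (measurableSet_setOfPred.1 (periodic r)).not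

theorem ae_isGeneric [NeZero m] [Nontrivial (Fin m)] : ∀ᵐ x ∂muFull m, IsGeneric x := by
  refine (ae_muFull_iff measurableSet_isGeneric).2 ?_
  filter_upwards [ae_mem_recurrentSet] with z hz
  have hl := (mem_recurrentSet_iff.1 hz).2
  have injective (r : ℤ) : Function.Injective fun i => onesIndex z (openPos z r i) := fun i j h =>
    openPos_injective hl r
      ((strictMonoOn_onesIndex z).injOn (apply_openPos hl r i) (apply_openPos hl r j) h)
  filter_upwards [ae_all_iff.2 fun r => ae_not_eventuallyPeriodic (A := Fin m) (injective r)]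
    with a ha
  rw [dyckF_eq_bracketSeq]
  refine ⟨by rwa [openPattern_bracketSeq], fun r => ?_⟩
  rw [funext (openStack_bracketSeq hl _ r)]
  exact ha r

end Generic

section HomoclinicPoints

variable {m : ℕ}

theorem openStack_eq_of_eqOn_Ici {x y : ℤ → DyckLetter m} (hx : LeftUnbounded (openPattern x))
    (hy : LeftUnbounded (openPattern y)) (hmx : IsMatched x) (hmy : IsMatched y)
    (hxR : RightUnbounded (openPattern x)) {r : ℤ} (h : ∀ k ≥ r, x k = y k) :
    openStack x r = openStack y r := by
  funext i
  by_contra hne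
  obtain ⟨l, hl, height_le⟩ := hxR r (height (openPattern x) r - i - 1)
  obtain ⟨q, rfl⟩ := Int.le.dest hl.le
  have run_x := stackRun_blockList hx hmx r q
  have run_y := stackRun_blockList hy hmy r q
  rw [← blockList_eq_iff.2 fun k hk _ => h k hk] at run_y
  have unmatched_le : unmatchedCount (blockList x r q) ≤ i := by
    by_contra! hlt
    exact hne ((stackRun_ne_none_iff (by simp [run_y])).1 (by simp [run_x]) i hlt)
  have := unmatchedCount_add_wordHeight_nonneg (blockList x r q)
  rw [wordHeight_blockList] at this
  omega

theorem wordHeight_eq_of_stackRun_eq {u v : List (DyckLetter m)} {s t : ℕ → Fin m}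
    (hu : stackRun u s = some t) (hv : stackRun v s = some t) (hs : ¬ EventuallyPeriodic s) :
    wordHeight u = wordHeight v := by
  by_contra hne
  wlog hlt : wordHeight u < wordHeight v generalizing u v
  · exact this hv hu (Ne.symm hne) (lt_of_le_of_ne (not_lt.1 hlt) (Ne.symm hne))
  obtain ⟨d, hd⟩ := Int.le.dest hlt.le
  refine hs ⟨d, by omega, max (unmatchedCount u) (unmatchedCount v), fun i hi => ?_⟩
  have unmatched_u : unmatchedCount u ≤ i := (le_max_left _ _).trans hi
  have unmatched_v : unmatchedCount v ≤ i := (le_max_right _ _).trans hi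
  obtain ⟨k, hk⟩ := Int.eq_ofNat_of_zero_le (a := i + wordHeight v) <| by
    have := unmatchedCount_add_wordHeight_nonneg v
    omega
  exact (stackRun_apply hu (unmatched_u.trans (Nat.le_add_right i d))
    (by push_cast; omega)).symm.trans (stackRun_apply hv unmatched_v hk.symm)

theorem exists_stackRun_append_eq {x : ℤ → DyckLetter m} (hx : LeftUnbounded (openPattern x))
    {r : ℤ} {u v : List (DyckLetter m)} {t : ℕ → Fin m} (hu : stackRun u (openStack x r) = some t)
    (hv : stackRun v (openStack x r) = some t) (huv : wordHeight u = wordHeight v) :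
    ∃ q : ℕ, ∀ s, stackRun (blockList x (r - q) q ++ u) s =
      stackRun (blockList x (r - q) q ++ v) s := by
  obtain ⟨q, hq⟩ : ∃ q : ℕ, ∀ i < max (unmatchedCount u) (unmatchedCount v),
      r - q ≤ openPos (openPattern x) r i := by
    refine ⟨(Finset.range (max (unmatchedCount u) (unmatchedCount v))).sup fun i =>
      (r - openPos (openPattern x) r i).natAbs, fun i hi => ?_⟩
    have := Finset.le_sup (f := fun i => (r - openPos (openPattern x) r i).natAbs)
      (Finset.mem_range.2 hi)
    omega
  refine ⟨q, fun s => ?_⟩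
  rw [stackRun_append, stackRun_append]
  cases hs : stackRun (blockList x (r - q) q) s with
  | none => rfl
  | some s' =>
    refine stackRun_eq_of_eqOn hu hv huv fun i hi => ?_
    rw [stackRun_blockList_apply hx (by rw [sub_add_cancel]; exact hq i hi) hs, sub_add_cancel]

/-- The sequences agree outside `[-N, N]`, and their blocks on this interval have the same
action. -/
def TailEquiv (N : ℕ) (x y : ℤ → DyckLetter m) : Prop :=
  (∀ k : ℤ, (N : ℤ) < |k| → x k = y k) ∧
    SameAction (blockList x (-N) (2 * N + 1)) (blockList y (-N) (2 * N + 1))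

theorem TailEquiv.symm {N : ℕ} {x y : ℤ → DyckLetter m} (h : TailEquiv N x y) :
    TailEquiv N y x := ⟨fun k hk => (h.1 k hk).symm, h.2.symm⟩

theorem exists_tailEquiv_of_stackRun_eq {x y : ℤ → DyckLetter m}
    (hx : LeftUnbounded (openPattern x)) {n : ℕ} (hxy : ∀ k : ℤ, (n : ℤ) < |k| → x k = y k)
    {t : ℕ → Fin m} (hu : stackRun (blockList x (-n) (2 * n + 1)) (openStack x (-n)) = some t)
    (hv : stackRun (blockList y (-n) (2 * n + 1)) (openStack x (-n)) = some t)
    (height_eq : wordHeight (blockList x (-n) (2 * n + 1)) =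
      wordHeight (blockList y (-n) (2 * n + 1))) :
    ∃ N, TailEquiv N x y := by
  obtain ⟨q, hq⟩ := exists_stackRun_append_eq hx hu hv height_eq
  have agree (k : ℤ) (hk : k < -n ∨ n + 1 ≤ k) : x k = y k := hxy k (by rw [lt_abs]; omega)
  have left : blockList y (-n - q) q = blockList x (-n - q) q :=
    blockList_eq_iff.2 fun k _ hk => (agree k (.inl (by omega))).symm
  have right : blockList y (n + 1) q = blockList x (n + 1) q :=
    blockList_eq_iff.2 fun k hk _ => (agree k (.inr hk)).symm
  have openings_eq : (blockList x (-n) (2 * n + 1)).countP DyckLetter.isOpening =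
      (blockList y (-n) (2 * n + 1)).countP DyckLetter.isOpening := by
    rw [wordHeight, wordHeight, length_blockList, length_blockList] at height_eq
    omega
  have same : SameAction (blockList x (-n - q) q ++ blockList x (-n) (2 * n + 1))
      (blockList x (-n - q) q ++ blockList y (-n) (2 * n + 1)) :=
    ⟨hq, by rw [List.countP_append, List.countP_append, openings_eq]⟩
  refine ⟨n + q, fun k hk => hxy k (by omega), ?_⟩
  rw [blockList_centred x (Nat.le_add_right n q), blockList_centred y (Nat.le_add_right n q),
    Nat.add_sub_cancel_left, Nat.cast_add, neg_add', left, right, ← List.append_assoc,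
    ← List.append_assoc]
  exact same.append [] _

theorem exists_tailEquiv [NeZero m] {x y : dyckShift m} (hx : IsGeneric x.1)
    (hxy : DoubleTail x y) : ∃ N, TailEquiv N x.1 y.1 := by
  obtain ⟨n, hn⟩ := hxy
  obtain ⟨hxR, hxL⟩ := mem_recurrentSet_iff.1 hx.1
  have agree_left (k : ℤ) (hk : k < -n) : x.1 k = y.1 k := hn k (by rw [lt_abs]; omega)
  have agree_right (k : ℤ) (hk : k ≥ -n + (2 * n + 1 : ℕ)) : x.1 k = y.1 k :=
    hn k (by rw [lt_abs]; omega)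
  have hyL : LeftUnbounded (openPattern y.1) :=
    hxL.congr fun k hk => by rw [openPattern, openPattern, agree_left k hk]
  have hmx := isMatched_of_mem_dyckShift x.2 hxL
  have hmy := isMatched_of_mem_dyckShift y.2 hyL
  have run_x := stackRun_blockList hxL hmx (-n) (2 * n + 1)
  have run_y := stackRun_blockList hyL hmy (-n) (2 * n + 1)
  rw [← openStack_congr hxL agree_left,
    ← openStack_eq_of_eqOn_Ici hxL hyL hmx hmy hxR agree_right] at run_y
  exact exists_tailEquiv_of_stackRun_eq hxL hn run_x run_y
    (wordHeight_eq_of_stackRun_eq run_x run_y (hx.2 (-n)))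

end HomoclinicPoints

/-! ### Double-tail invariance -/

section Invariance

variable {m : ℕ} [NeZero m] [Nontrivial (Fin m)] {Ω : Type*}

theorem muFull_image_eq_of_sameAction {f g : Ω → ℤ → DyckLetter m} {P : Set Ω} {N : ℕ}
    {u v : List (DyckLetter m)} (huv : SameAction u v) (hP : MeasurableSet (f '' P))
    (agree : ∀ ω ∈ P, ∀ k : ℤ, (N : ℤ) < |k| → f ω k = g ω k)
    (hf : ∀ ω ∈ P, blockList (f ω) (-N) (2 * N + 1) = u)
    (hg : ∀ ω ∈ P, blockList (g ω) (-N) (2 * N + 1) = v) :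
    muFull m (f '' P) = muFull m (g '' P) := by
  rcases P.eq_empty_or_nonempty with rfl | ⟨ω₀, h₀⟩
  · rw [Set.image_empty, Set.image_empty]
  obtain rfl := hf ω₀ h₀
  obtain rfl := hg ω₀ h₀
  rw [← muFull_image_replaceBlock huv hP (Set.image_subset_iff.2 fun ω hω => hf ω hω),
    Set.image_image]
  congr 1
  refine Set.image_congr fun ω hω => funext fun k => ?_
  unfold replaceBlock
  split_ifs with hk
  · exact (blockList_eq_iff.1 (hg ω hω) k hk.1 hk.2).symm
  · exact agree ω hω k (by rw [lt_abs]; push_cast at hk; omega)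

variable [MeasurableSpace Ω]

theorem ae_comap_isGeneric {f : Ω → ℤ → DyckLetter m} (hf : MeasurableEmbedding f) :
    ∀ᵐ ω ∂(muFull m).comap f, IsGeneric (f ω) := by
  rw [← hf.ae_map_iff, hf.map_comap]
  exact ae_restrict_of_ae ae_isGeneric

theorem comap_muFull_eq {f g : Ω → ℤ → DyckLetter m} (hf : MeasurableEmbedding f)
    (hg : MeasurableEmbedding g)
    (h : ∀ ω, IsGeneric (f ω) ∨ IsGeneric (g ω) → ∃ N, TailEquiv N (f ω) (g ω)) :
    (muFull m).comap f = (muFull m).comap g := by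
  let piece (i : ℕ × {p : List (DyckLetter m) × List (DyckLetter m) // SameAction p.1 p.2}) :
      Set Ω :=
    {ω | (∀ k : ℤ, (i.1 : ℤ) < |k| → f ω k = g ω k) ∧
      blockList (f ω) (-i.1) (2 * i.1 + 1) = i.2.1.1 ∧
      blockList (g ω) (-i.1) (2 * i.1 + 1) = i.2.1.2}
  have mem_piece {ω : Ω} (hω : ∃ N, TailEquiv N (f ω) (g ω)) : ω ∈ ⋃ i, piece i := by
    obtain ⟨N, hN⟩ := hω
    exact Set.mem_iUnion.2 ⟨⟨N, ⟨(_, _), hN.2⟩⟩, hN.1, rfl, rfl⟩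
  have measurable_piece (i) : MeasurableSet (piece i) := by
    have agree (k : ℤ) : MeasurableSet {ω | f ω k = g ω k} :=
      measurableSet_eq_fun ((measurable_pi_apply k).comp hf.measurable)
        ((measurable_pi_apply k).comp hg.measurable)
    refine MeasurableSet.inter ?_ ((hf.measurable (measurableSet_blockList_eq _ _ _)).inter
      (hg.measurable (measurableSet_blockList_eq _ _ _)))
    exact measurableSet_setOfPred.2 <| .forall fun k =>
      measurable_const.imp (measurableSet_setOfPred.1 (agree k))
  rw [← Measure.restrict_eq_self_of_ae_mem
      ((ae_comap_isGeneric hf).mono fun ω hω => mem_piece (h ω (.inl hω))),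
    ← Measure.restrict_eq_self_of_ae_mem (μ := (muFull m).comap g)
      ((ae_comap_isGeneric hg).mono fun ω hω => mem_piece (h ω (.inr hω))),
    Measure.restrict_iUnion_congr]
  intro i
  ext P hP
  rw [Measure.restrict_apply hP, Measure.restrict_apply hP, hf.comap_apply, hg.comap_apply]
  exact muFull_image_eq_of_sameAction i.2.2
    (hf.measurableSet_image.2 (hP.inter (measurable_piece i)))
    (fun ω hω => hω.2.1) (fun ω hω => hω.2.2.1) fun ω hω => hω.2.2.2

instance : StandardBorelSpace (dyckShift m) := measurableSet_dyckShift.standardBorel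

theorem doubleTailInvariant_muTilde : DoubleTailInvariant (muTilde m) := by
  intro S g hg
  have := hg.measurableSet_domain.standardBorel
  have embedding_S : MeasurableEmbedding fun x : S => x.1.1 :=
    measurableEmbedding_val.comp (MeasurableEmbedding.subtype_coe hg.measurableSet_domain)
  have embedding_g : MeasurableEmbedding fun x : S => (g x).1 :=
    measurableEmbedding_val.comp (hg.measurable.measurableEmbedding hg.injective)
  have comap_eq := comap_muFull_eq embedding_S embedding_g fun x hx => by
    rcases hx with hx | hx
    · exact exists_tailEquiv hx (hg.doubleTail x)
    · have symm : DoubleTail (g x) x.1 :=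
        (hg.doubleTail x).imp fun n hn k hk => (hn k hk).symm
      exact (exists_tailEquiv hx symm).imp fun N hN => hN.symm
  have mass_eq := congrArg (fun μ => μ Set.univ) comap_eq
  simp only [embedding_S.comap_apply, embedding_g.comap_apply, Set.image_univ] at mass_eq
  rw [muTilde_apply, muTilde_apply, ← Set.range_comp, Set.image_eq_range]
  exact mass_eq

end Invariance

/-! ### Entropy of finite partitions -/

section Entropy

open Real

theorem negMulLog_sum_le {ι : Type*} (s : Finset ι) {p : ι → ℝ} (hp : ∀ i ∈ s, 0 ≤ p i) :
    negMulLog (∑ i ∈ s, p i) ≤ ∑ i ∈ s, negMulLog (p i) := by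
  rw [negMulLog, ← Finset.sum_neg_distrib, Finset.sum_mul]
  refine Finset.sum_le_sum fun i hi => ?_
  rcases (hp i hi).eq_or_lt with h | h
  · simp [← h]
  · exact mul_le_mul_of_nonpos_left (log_le_log h (Finset.single_le_sum hp hi)) (by linarith)

theorem negMulLog_le_neg_mul_log_add {p q : ℝ} (hp : 0 ≤ p) (hq : 0 ≤ q) (h : q = 0 → p = 0) :
    negMulLog p ≤ -p * log q + (q - p) := by
  rcases hp.eq_or_lt with rfl | hp
  · simpa
  have hq : 0 < q := hq.lt_of_ne' fun e => hp.ne' (h e)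
  have hlog := mul_le_mul_of_nonneg_left (log_le_sub_one_of_pos (div_pos hq hp)) hp.le
  rw [log_div hq.ne' hp.ne', mul_sub, mul_sub, mul_one, mul_div_cancel₀ _ hp.ne'] at hlog
  rw [negMulLog]
  linarith

theorem sum_negMulLog_le_neg_mul_log {ι : Type*} {s : Finset ι} {p q : ι → ℝ}
    (hp : ∀ i ∈ s, 0 ≤ p i) (hq : ∀ i ∈ s, 0 ≤ q i) (h : ∀ i ∈ s, q i = 0 → p i = 0)
    (hsum : ∑ i ∈ s, q i ≤ ∑ i ∈ s, p i) :
    ∑ i ∈ s, negMulLog (p i) ≤ ∑ i ∈ s, -p i * log (q i) := by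
  have := Finset.sum_le_sum fun i hi => negMulLog_le_neg_mul_log_add (hp i hi) (hq i hi) (h i hi)
  rw [Finset.sum_add_distrib, Finset.sum_sub_distrib] at this
  linarith

theorem sum_negMulLog_le_add_marginals {ι κ : Type*} [Fintype ι] [Fintype κ] {p : ι → κ → ℝ}
    (hp : ∀ i j, 0 ≤ p i j) (hsum : ∑ i, ∑ j, p i j = 1) :
    ∑ i, ∑ j, negMulLog (p i j) ≤
      ∑ i, negMulLog (∑ j, p i j) + ∑ j, negMulLog (∑ i, p i j) := by
  set a : ι → ℝ := fun i => ∑ j, p i j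
  set b : κ → ℝ := fun j => ∑ i, p i j
  have hab : ∀ i j, a i * b j = 0 → p i j = 0 := by
    intro i j h
    rcases mul_eq_zero.1 h with h | h
    · exact (Finset.sum_eq_zero_iff_of_nonneg fun j _ => hp i j).1 h j (Finset.mem_univ j)
    · exact (Finset.sum_eq_zero_iff_of_nonneg fun i _ => hp i j).1 h i (Finset.mem_univ i)
  have hlog : ∀ i j, -p i j * log (a i * b j) = -p i j * log (a i) + -p i j * log (b j) := by
    intro i j
    by_cases h : p i j = 0
    · simp [h]
    · have := mul_ne_zero_iff.1 (mt (hab i j) h)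
      rw [log_mul this.1 this.2, mul_add]
  have hb : ∑ j, b j = 1 := by rw [← hsum, Finset.sum_comm]
  have hmass : ∑ ij : ι × κ, a ij.1 * b ij.2 = ∑ ij : ι × κ, p ij.1 ij.2 := by
    rw [Fintype.sum_prod_type, Fintype.sum_prod_type, hsum, ← Finset.sum_mul_sum, hsum, hb, one_mul]
  calc ∑ i, ∑ j, negMulLog (p i j) ≤ ∑ i, ∑ j, -p i j * log (a i * b j) := by
        rw [← Fintype.sum_prod_type', ← Fintype.sum_prod_type']
        exact sum_negMulLog_le_neg_mul_log (fun ij _ => hp ij.1 ij.2)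
          (fun ij _ => mul_nonneg (Finset.sum_nonneg fun j _ => hp _ j)
            (Finset.sum_nonneg fun i _ => hp i _))
          (fun ij _ => hab ij.1 ij.2) hmass.le
    _ = ∑ i, ∑ j, -p i j * log (a i) + ∑ j, ∑ i, -p i j * log (b j) := by
        simp only [hlog, Finset.sum_add_distrib]
        rw [Finset.sum_comm (f := fun i j => -p i j * log (b j))]
    _ = ∑ i, negMulLog (a i) + ∑ j, negMulLog (b j) := by
        simp only [← Finset.sum_mul, Finset.sum_neg_distrib, negMulLog, a, b]

theorem exists_forall_negMulLog_lt {ε : ℝ} (hε : 0 < ε) :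
    ∃ δ > 0, ∀ x, |x| < δ ∨ |x - 1| < δ → negMulLog x < ε := by
  have hnear : ∀ y, negMulLog y = 0 → ∃ δ > 0, ∀ x, |x - y| < δ → negMulLog x < ε := fun y hy =>
    Metric.eventually_nhds_iff.1
      ((continuous_negMulLog.tendsto y).eventually_lt_const (hy.trans_lt hε))
  obtain ⟨δ₀, hδ₀, h₀⟩ := hnear 0 negMulLog_zero
  obtain ⟨δ₁, hδ₁, h₁⟩ := hnear 1 negMulLog_one
  refine ⟨min δ₀ δ₁, lt_min hδ₀ hδ₁, ?_⟩
  rintro x (h | h)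
  · exact h₀ x (by rw [sub_zero]; exact h.trans_le (min_le_left _ _))
  · exact h₁ x (h.trans_le (min_le_right _ _))

section Partitions

variable {Ω ι κ : Type*} [MeasurableSpace Ω] [MeasurableSpace ι] {μ : Measure Ω} {P : Ω → ι}
  {Q : Ω → κ} {T : Ω → Ω}

theorem measurable_itinerary (hP : Measurable P) (hT : Measurable T) (n : ℕ) :
    Measurable (itinerary T P n) :=
  measurable_pi_lambda _ fun j => hP.comp (hT.iterate j)

theorem entropyOfPartition_le_of_tendsto {ι : Type*} [Fintype ι] {P : Ω → ι} {b : ℕ → ℝ} {h : ℝ}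
    (hb : Tendsto b atTop (nhds h))
    (hle : ∀ᶠ n : ℕ in atTop, partitionEntropy μ (itinerary T P n) / n ≤ b n) :
    entropyOfPartition μ T P ≤ (h : EReal) := by
  rw [← ((continuous_coe_real_ereal.tendsto h).comp hb).limsup_eq]
  exact limsup_le_limsup (hle.mono fun n hn => EReal.coe_le_coe hn)

theorem le_entropyOfPartition_of_tendsto {ι : Type*} [Fintype ι] {P : Ω → ι} {b : ℕ → ℝ} {h : ℝ}
    (hb : Tendsto b atTop (nhds h))
    (hle : ∀ᶠ n : ℕ in atTop, b n ≤ partitionEntropy μ (itinerary T P n) / n) :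
    (h : EReal) ≤ entropyOfPartition μ T P := by
  rw [← ((continuous_coe_real_ereal.tendsto h).comp hb).limsup_eq]
  exact limsup_le_limsup (hle.mono fun n hn => EReal.coe_le_coe hn)

variable [MeasurableSingletonClass ι] [Fintype ι]

theorem partitionEntropy_eq_integral [IsFiniteMeasure μ] (hP : Measurable P) :
    partitionEntropy μ P = ∫ x, -log (μ.real (P ⁻¹' {P x})) ∂μ := by
  rw [← integral_map (f := fun i => -log (μ.real (P ⁻¹' {i}))) hP.aemeasurable
    (measurable_of_finite _).aestronglyMeasurable, integral_fintype .of_finite]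
  refine Finset.sum_congr rfl fun i _ => ?_
  rw [map_measureReal_apply hP (measurableSet_singleton i), negMulLog, smul_eq_mul, mul_neg,
    neg_mul]

theorem partitionEntropy_comp_measurePreserving (hP : Measurable P)
    (hT : MeasurePreserving T μ μ) : partitionEntropy μ (P ∘ T) = partitionEntropy μ P := by
  refine Finset.sum_congr rfl fun i _ => ?_
  rw [Set.preimage_comp, hT.measureReal_preimage (hP (measurableSet_singleton i)).nullMeasurableSet]

variable [Fintype κ] [IsProbabilityMeasure μ]

theorem partitionEntropy_comp_le (hP : Measurable P) (f : ι → κ) :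
    partitionEntropy μ (f ∘ P) ≤ partitionEntropy μ P := by
  classical
  have hfibre : ∀ j, μ.real (f ∘ P ⁻¹' {j}) = ∑ i with f i = j, μ.real (P ⁻¹' {i}) := by
    intro j
    rw [sum_measureReal_preimage_singleton _ fun i _ => hP (measurableSet_singleton i)]
    congr 1
    ext x
    simp
  simp only [partitionEntropy, hfibre]
  rw [← Finset.sum_fiberwise (s := Finset.univ) (g := f)]
  exact Finset.sum_le_sum fun j _ => negMulLog_sum_le _ fun i _ => measureReal_nonneg

theorem partitionEntropy_le_of_factorsThrough (hP : Measurable P) (h : Q.FactorsThrough P) :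
    partitionEntropy μ Q ≤ partitionEntropy μ P := by
  obtain ⟨x₀⟩ : Nonempty Ω := nonempty_of_isProbabilityMeasure μ
  rw [← h.extend_comp (fun _ => Q x₀)]
  exact partitionEntropy_comp_le hP _

variable [MeasurableSpace κ] [MeasurableSingletonClass κ]

theorem sum_measureReal_preimage_prodMk {ι : Type*} [MeasurableSpace ι]
    [MeasurableSingletonClass ι] {P : Ω → ι} (hP : Measurable P) (hQ : Measurable Q)
    (i : ι) : ∑ j, μ.real ((fun x => (P x, Q x)) ⁻¹' {(i, j)}) =
      μ.real (P ⁻¹' {i}) := by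
  have := sum_measureReal_preimage_singleton (μ := μ) ({i} ×ˢ Finset.univ)
    (f := fun x => (P x, Q x)) fun y _ => hP.prodMk hQ (measurableSet_singleton y)
  rw [Finset.sum_product, Finset.sum_singleton] at this
  rw [this]
  congr 1
  ext x
  simp [eq_comm]

theorem partitionEntropy_prodMk_le (hP : Measurable P) (hQ : Measurable Q) :
    partitionEntropy μ (fun x => (P x, Q x)) ≤ partitionEntropy μ P + partitionEntropy μ Q := by
  set p : ι → κ → ℝ := fun i j => μ.real ((fun x => (P x, Q x)) ⁻¹' {(i, j)})
  have hfst : ∀ i, ∑ j, p i j = μ.real (P ⁻¹' {i}) := sum_measureReal_preimage_prodMk hP hQ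
  have hsnd : ∀ j, ∑ i, p i j = μ.real (Q ⁻¹' {j}) := by
    intro j
    rw [← sum_measureReal_preimage_prodMk hQ hP]
    refine Finset.sum_congr rfl fun i _ => congrArg μ.real ?_
    ext x
    simp [and_comm]
  have hsum : ∑ i, ∑ j, p i j = 1 := by
    simp only [hfst]
    rw [sum_measureReal_preimage_singleton _ fun i _ => hP (measurableSet_singleton i)]
    simp
  have := sum_negMulLog_le_add_marginals (p := p) (fun _ _ => measureReal_nonneg) hsum
  simp only [hfst, hsnd] at this
  rwa [← Fintype.sum_prod_type'] at this

theorem partitionEntropy_itinerary_le (hP : Measurable P) (hT : MeasurePreserving T μ μ) (n : ℕ) :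
    partitionEntropy μ (itinerary T P n) ≤ n * partitionEntropy μ P := by
  induction n with
  | zero =>
    have h : itinerary T P 0 ⁻¹' {default} = Set.univ :=
      Set.eq_univ_of_forall fun x => Subsingleton.elim _ _
    simp [partitionEntropy, h]
  | succ n ih =>
    have hI := measurable_itinerary hP hT.measurable n
    have hfactor : (itinerary T P (n + 1)).FactorsThrough
        fun x => (P x, (itinerary T P n ∘ T) x) := fun x y hxy =>
      funext (Fin.cases (congrArg Prod.fst hxy) fun j => congrFun (congrArg Prod.snd hxy) j)
    calc partitionEntropy μ (itinerary T P (n + 1))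
        ≤ partitionEntropy μ P + partitionEntropy μ (itinerary T P n ∘ T) :=
          (partitionEntropy_le_of_factorsThrough (hP.prodMk (hI.comp hT.measurable))
            hfactor).trans (partitionEntropy_prodMk_le hP (hI.comp hT.measurable))
      _ ≤ partitionEntropy μ P + n * partitionEntropy μ P := by
          rw [partitionEntropy_comp_measurePreserving hI hT]
          gcongr
      _ = (n + 1 : ℕ) * partitionEntropy μ P := by push_cast; ring

theorem partitionEntropy_itinerary_le_add {ι' : Type*} [Fintype ι'] {R : Ω → ι'}
    (hP : Measurable P) (hQ : Measurable Q) (f : ι → κ → ι') (hR : ∀ x, R x = f (P x) (Q x))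
    (hT : MeasurePreserving T μ μ) (n : ℕ) :
    partitionEntropy μ (itinerary T R n) ≤
      partitionEntropy μ (itinerary T P n) + n * partitionEntropy μ Q := by
  have hPn := measurable_itinerary hP hT.measurable n
  have hQn := measurable_itinerary hQ hT.measurable n
  have hfactor : (itinerary T R n).FactorsThrough
      fun x => (itinerary T P n x, itinerary T Q n x) := by
    intro x y hxy
    obtain ⟨hPxy, hQxy⟩ := Prod.mk.inj hxy
    funext j
    exact (hR _).trans ((congrArg₂ f (congrFun hPxy j) (congrFun hQxy j)).trans (hR _).symm)
  calc partitionEntropy μ (itinerary T R n)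
      ≤ partitionEntropy μ (itinerary T P n) + partitionEntropy μ (itinerary T Q n) :=
        (partitionEntropy_le_of_factorsThrough (hPn.prodMk hQn) hfactor).trans
          (partitionEntropy_prodMk_le hPn hQn)
    _ ≤ _ := by gcongr; exact partitionEntropy_itinerary_le hQ hT n

theorem exists_partitionEntropy_lt (i₀ : ι) {ε : ℝ} (hε : 0 < ε) :
    ∃ δ > 0, ∀ {μ : Measure Ω} [IsProbabilityMeasure μ] {P : Ω → ι}, Measurable P →
      μ.real {x | P x ≠ i₀} < δ → partitionEntropy μ P < ε := by
  have hcard : (0 : ℝ) < Fintype.card ι := by exact_mod_cast Fintype.card_pos_iff.2 ⟨i₀⟩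
  obtain ⟨δ, hδ, hsmall⟩ := exists_forall_negMulLog_lt (div_pos hε hcard)
  refine ⟨δ, hδ, fun {μ} _ {P} hP hlt => ?_⟩
  have hterm : ∀ i, negMulLog (μ.real (P ⁻¹' {i})) < ε / Fintype.card ι := by
    intro i
    apply hsmall
    rcases eq_or_ne i i₀ with rfl | hi
    · right
      have hcompl : {x | P x ≠ i} = (P ⁻¹' {i})ᶜ := rfl
      rw [hcompl, probReal_compl_eq_one_sub (hP (measurableSet_singleton i))] at hlt
      rwa [abs_sub_comm, abs_of_nonneg (sub_nonneg.2 measureReal_le_one)]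
    · left
      rw [abs_of_nonneg measureReal_nonneg]
      refine (measureReal_mono fun x hx => ?_).trans_lt hlt
      exact (Set.mem_singleton_iff.1 hx).trans_ne hi
  calc partitionEntropy μ P < ∑ _i : ι, ε / Fintype.card ι :=
        Finset.sum_lt_sum_of_nonempty ⟨i₀, Finset.mem_univ _⟩ fun i _ => hterm i
    _ = ε := by
        rw [Finset.sum_const, Finset.card_univ, nsmul_eq_mul, mul_div_cancel₀ _ hcard.ne']

end Partitions

end Entropy

/-! ### Kolmogorov–Sinai entropy -/

section WordEntropy

open Real

variable {m : ℕ}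

/-- The partition of the Dyck shift according to the word read on `[r, r + n)`. -/
def wordAt (r : ℤ) (n : ℕ) (x : dyckShift m) (j : Fin n) : DyckLetter m := x.1 (r + (j : ℕ))

theorem measurable_wordAt (r : ℤ) (n : ℕ) : Measurable (wordAt (m := m) r n) :=
  measurable_pi_lambda _ fun _ => (measurable_pi_apply _).comp measurable_subtype_coe

theorem wordAt_eq_iff {r : ℤ} {n : ℕ} {x y : dyckShift m} :
    wordAt r n x = wordAt r n y ↔ x.1 ∈ cylSet y.1 r n := by
  rw [mem_cylSet_iff_forall, funext_iff]
  constructor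
  · intro h k hk hk'
    obtain ⟨i, rfl⟩ := Int.le.dest hk
    exact h ⟨i, by omega⟩
  · intro h j
    exact h _ (by omega) (by omega)

theorem unmatchedCount_blockList (x : ℤ → DyckLetter m) (r : ℤ) (n : ℕ) :
    unmatchedCount (blockList x r n) = walkDepth n fun i => openPattern x (r + i) := by
  induction n generalizing r with
  | zero => rfl
  | succ n ih =>
    have tail (i : ℕ) : r + (i + 1 : ℕ) = r + 1 + i := by
      push_cast
      ring
    simp only [blockList_succ, walkDepth, tail, ← ih, Nat.cast_zero, add_zero]
    cases hx : x r <;> simp [openPattern, hx, unmatchedCount]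

/-- The entropy of the partition into words of length `n`: by `neg_log_measureReal_wordAt` the
information in a word is `log 2` for each letter and `log m` for each opening and each unmatched
closing bracket. -/
noncomputable def wordEntropy (m n : ℕ) : ℝ :=
  n * log 2 + (n / 2 + ∫ w, (walkDepth n w : ℝ) ∂coinMeasure) * log m

theorem tendsto_wordEntropy_div (k : ℕ) :
    Tendsto (fun n : ℕ => wordEntropy m (n + k) / n) atTop (nhds (log 2 + 1 / 2 * log m)) := by
  have hratio : Tendsto (fun n : ℕ => wordEntropy m n / n) atTop
      (nhds (log 2 + (1 / 2 + 0) * log m)) := by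
    refine (((tendsto_integral_walkDepth_div.const_add (1 / 2)).mul_const (log m)).const_add
      (log 2)).congr' ?_
    filter_upwards [eventually_gt_atTop 0] with n hn
    have : (n : ℝ) ≠ 0 := by positivity
    rw [wordEntropy]
    field_simp
  have hshift : Tendsto (fun n : ℕ => ((n + k : ℕ) : ℝ) / n) atTop (nhds 1) := by
    have := (tendsto_const_div_atTop_nhds_zero_nat (k : ℝ)).const_add 1
    rw [add_zero] at this
    refine this.congr' ?_
    filter_upwards [eventually_gt_atTop 0] with n hn
    have : (n : ℝ) ≠ 0 := by positivity
    push_cast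
    field_simp
  have hprod := (hratio.comp (tendsto_add_atTop_nat k)).mul hshift
  rw [add_zero, mul_one] at hprod
  refine hprod.congr' ?_
  filter_upwards [eventually_gt_atTop 0] with n hn
  have : ((n + k : ℕ) : ℝ) ≠ 0 := by positivity
  exact div_mul_div_cancel₀ this

variable [NeZero m]

theorem measurePreserving_openPattern_muTilde (r : ℤ) : MeasurePreserving
    (fun (x : dyckShift m) (i : ℕ) => openPattern x.1 (r + i)) (muTilde m) coinMeasure := by
  have hval : MeasurePreserving Subtype.val (muTilde m) (muFull m) :=
    ⟨measurable_subtype_coe, map_val_muTilde⟩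
  have hpattern : MeasurePreserving openPattern (muFull m) (symmetricProduct Bool) := by
    refine ⟨measurable_openPattern, ?_⟩
    have hfst : openPattern ∘ dyckF (m := m) = Prod.fst :=
      funext fun _ => openPattern_bracketSeq _ _
    rw [muFull_eq_map, Measure.map_map measurable_openPattern measurable_dyckF, hfst]
    exact measurePreserving_fst.map_eq
  exact (measurePreserving_right_steps r).comp (hpattern.comp hval)

theorem neg_log_measureReal_wordAt (r : ℤ) (n : ℕ) (x : dyckShift m) :
    -log ((muTilde m).real (wordAt r n ⁻¹' {wordAt r n x})) =
      n * log 2 + (upCount n (fun i => openPattern x.1 (r + i)) +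
        walkDepth n fun i => openPattern x.1 (r + i)) * log m := by
  have hm : (m : ℝ) ≠ 0 := NeZero.ne _
  have hfibre : wordAt r n ⁻¹' {wordAt r n x} = Subtype.val ⁻¹' cylSet x.1 r n :=
    Set.ext fun _ => wordAt_eq_iff
  have hadmissible : ∃ s, stackRun (blockList x.1 r n) s ≠ none := by
    rw [← toList_block, ← mem_dyckLanguage_iff]
    exact x.2 r n
  rw [hfibre, ← map_measureReal_apply measurable_subtype_coe (measurableSet_cylSet _ _ _),
    map_val_muTilde, measureReal_def, muFull_cylSet, labelWeight, if_pos hadmissible,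
    countP_blockList, unmatchedCount_blockList, ENNReal.toReal_mul, ENNReal.toReal_pow,
    ENNReal.toReal_pow, ENNReal.toReal_inv, ENNReal.toReal_inv, ENNReal.toReal_natCast,
    ENNReal.toReal_ofNat, log_mul (by positivity) (by positivity), log_pow, log_pow, log_inv,
    log_inv]
  push_cast [openPattern]
  ring

theorem partitionEntropy_wordAt (r : ℤ) (n : ℕ) :
    partitionEntropy (muTilde m) (wordAt r n) = wordEntropy m n := by
  have hint : Integrable (fun w => ((upCount n w : ℝ) + walkDepth n w) * log m) coinMeasure :=
    ((integrable_upCount n).add (integrable_walkDepth n)).mul_const (log m)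
  have hpattern := measurePreserving_openPattern_muTilde (m := m) r
  rw [partitionEntropy_eq_integral (measurable_wordAt r n)]
  simp only [neg_log_measureReal_wordAt]
  rw [← integral_map (f := fun w => n * log 2 + ((upCount n w : ℝ) + walkDepth n w) * log m)
      hpattern.measurable.aemeasurable
      (by rw [hpattern.map_eq]; exact ((integrable_const _).add hint).aestronglyMeasurable),
    hpattern.map_eq, integral_add (integrable_const _) hint,
    integral_mul_const (log m) fun w => (upCount n w : ℝ) + walkDepth n w,
    integral_add (integrable_upCount n) (integrable_walkDepth n), integral_upCount]
  simp [wordEntropy]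

end WordEntropy

section BlockApproximation

variable {A ι : Type*} [MeasurableSpace A] {μ : Measure (ℤ → A)} [IsFiniteMeasure μ]

theorem eventually_exists_measure_symmDiff_blockList_lt {B : Set (ℤ → A)} (hB : MeasurableSet B)
    {ε : ENNReal} (hε : 0 < ε) : ∀ᶠ N : ℕ in atTop, ∃ S : Set (List A),
      μ (symmDiff {x | blockList x (-N) (2 * N + 1) ∈ S} B) < ε := by
  obtain ⟨t, ht, hlt⟩ : ∃ t ∈ measurableCylinders fun _ : ℤ => A, μ (symmDiff t B) < ε :=
    exists_measure_symmDiff_lt_of_generateFrom_isSetRing isSetRing_measurableCylinders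
      ⟨{Set.univ}, Set.countable_singleton _,
        Set.singleton_subset_iff.2 (univ_mem_measurableCylinders _), by simp⟩
      generateFrom_measurableCylinders.symm hB hε
  obtain ⟨I, S, -, rfl⟩ := (mem_measurableCylinders _).1 ht
  filter_upwards [eventually_ge_atTop (I.sup Int.natAbs)] with N hN
  refine ⟨(fun x => blockList x (-N) (2 * N + 1)) '' cylinder I S, ?_⟩
  convert hlt using 3
  ext x
  refine ⟨?_, fun hx => ⟨x, hx, rfl⟩⟩
  rintro ⟨y, hy, hyx⟩
  rw [mem_cylinder] at hy ⊢
  convert hy using 1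
  funext k
  have := (Finset.le_sup (f := Int.natAbs) k.2).trans hN
  exact (blockList_eq_iff.1 hyx k (by omega) (by push_cast; omega)).symm

theorem exists_measureReal_ne_blockList_lt [Finite ι] [Nonempty ι] [MeasurableSpace ι]
    [MeasurableSingletonClass ι] {P : (ℤ → A) → ι} (hP : Measurable P) {δ : ℝ} (hδ : 0 < δ) :
    ∃ (N : ℕ) (q : List A → ι), μ.real {x | P x ≠ q (blockList x (-N) (2 * N + 1))} < δ := by
  classical
  have := Fintype.ofFinite ι
  set ε : ENNReal := ENNReal.ofReal δ / Fintype.card ι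
  have hcard : (Fintype.card ι : ENNReal) ≠ 0 := by exact_mod_cast Fintype.card_ne_zero
  have hε : 0 < ε := ENNReal.div_pos (ENNReal.ofReal_pos.2 hδ).ne' (ENNReal.natCast_ne_top _)
  obtain ⟨N, hN⟩ := (eventually_all.2 fun i : ι => eventually_exists_measure_symmDiff_blockList_lt
    (μ := μ) (hP (measurableSet_singleton i)) hε).exists
  choose S hS using hN
  set q : List A → ι := fun w => Classical.epsilon fun i => w ∈ S i
  have hsubset : {x | P x ≠ q (blockList x (-N) (2 * N + 1))} ⊆
      ⋃ i, symmDiff {x | blockList x (-N) (2 * N + 1) ∈ S i} (P ⁻¹' {i}) := by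
    intro x hx
    by_contra hgood
    have hiff : ∀ i, blockList x (-N) (2 * N + 1) ∈ S i ↔ P x = i := by
      simpa [Set.mem_symmDiff, iff_def] using hgood
    exact hx ((hiff _).1 (Classical.epsilon_spec (p := fun i => blockList x (-N) (2 * N + 1) ∈ S i)
      ⟨P x, (hiff _).2 rfl⟩))
  refine ⟨N, q, ENNReal.toReal_lt_of_lt_ofReal ?_⟩
  calc μ {x | P x ≠ q (blockList x (-N) (2 * N + 1))}
      ≤ ∑ i, μ (symmDiff {x | blockList x (-N) (2 * N + 1) ∈ S i} (P ⁻¹' {i})) :=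
        (measure_mono hsubset).trans (measure_iUnion_fintype_le _ _)
    _ < ∑ _i : ι, ε := ENNReal.sum_lt_sum_of_nonempty Finset.univ_nonempty fun i _ => hS i
    _ = ENNReal.ofReal δ := by
        rw [Finset.sum_const, Finset.card_univ, nsmul_eq_mul,
          ENNReal.mul_div_cancel hcard (ENNReal.natCast_ne_top _)]

end BlockApproximation

section KolmogorovSinai

open Real

variable {m : ℕ}

theorem iterate_dyckT_apply (j : ℕ) (x : dyckShift m) (k : ℤ) :
    ((dyckT m)^[j] x).1 k = x.1 (k + j) := by
  induction j generalizing x with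
  | zero => simp
  | succ j ih =>
    rw [Function.iterate_succ_apply, ih]
    exact congrArg x.1 (show k + j + 1 = k + (j + 1 : ℕ) by push_cast; ring)

variable [NeZero m]

theorem partitionEntropy_itinerary_blockList_le {ι : Type*} [Fintype ι]
    (q : List (DyckLetter m) → ι) (r : ℤ) (L n : ℕ) :
    partitionEntropy (muTilde m)
      (itinerary (dyckT m) (fun x => q (blockList x.1 r (L + 1))) n) ≤ wordEntropy m (n + L) := by
  rw [← partitionEntropy_wordAt r]
  refine partitionEntropy_le_of_factorsThrough (measurable_wordAt _ _) fun x y hxy => ?_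
  rw [wordAt_eq_iff, mem_cylSet_iff_forall] at hxy
  funext j
  refine congrArg q (blockList_eq_iff.2 fun k hk hk' => ?_)
  rw [iterate_dyckT_apply, iterate_dyckT_apply]
  exact hxy _ (by omega) (by push_cast at *; omega)

theorem exists_partitionEntropy_itinerary_le {k : ℕ} {P : dyckShift m → Fin k}
    (hP : Measurable P) {ε : ℝ} (hε : 0 < ε) : ∃ L : ℕ, ∀ n,
      partitionEntropy (muTilde m) (itinerary (dyckT m) P n) ≤ wordEntropy m (n + L) + n * ε := by
  obtain ⟨x₀⟩ : Nonempty (dyckShift m) := nonempty_of_isProbabilityMeasure (muTilde m)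
  have : Nonempty (Fin k) := ⟨P x₀⟩
  obtain ⟨P', hP', hext⟩ := measurableEmbedding_val.exists_measurable_extend hP fun _ => this
  obtain ⟨δ, hδ, hsmall⟩ := exists_partitionEntropy_lt (Ω := dyckShift m) (0 : Fin (k + 1)) hε
  obtain ⟨N, q, hq⟩ := exists_measureReal_ne_blockList_lt (μ := muFull m) hP' hδ
  set Q : dyckShift m → Fin k := fun x => q (blockList x.1 (-N) (2 * N + 1))
  have hQ' : Measurable fun x : ℤ → DyckLetter m => q (blockList x (-N) (2 * N + 1)) :=
    measurable_blockList_comp _ _ q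
  have hQ : Measurable Q := hQ'.comp measurable_subtype_coe
  -- The error partition records the value of `P` only where it differs from `Q`.
  set E : dyckShift m → Fin (k + 1) := fun x => if P x = Q x then 0 else (P x).succ
  have hE : Measurable E := (measurable_of_finite fun p : Fin k × Fin k =>
    if p.1 = p.2 then 0 else p.1.succ).comp (hP.prodMk hQ)
  have hEsmall : (muTilde m).real {x | E x ≠ 0} < δ := by
    have hne : MeasurableSet {x | P' x ≠ q (blockList x (-N) (2 * N + 1))} :=
      (measurableSet_eq_fun hP' hQ').compl
    have hpreimage : {x | E x ≠ 0} =
        Subtype.val ⁻¹' {x | P' x ≠ q (blockList x (-N) (2 * N + 1))} := by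
      ext x
      simp [E, Q, ← hext]
    rwa [hpreimage, ← map_measureReal_apply measurable_subtype_coe hne, map_val_muTilde]
  have hrecover : ∀ x, P x = Fin.cases (Q x) id (E x) := by
    intro x
    by_cases h : P x = Q x <;> simp [E, h]
  refine ⟨2 * N, fun n => ?_⟩
  calc partitionEntropy (muTilde m) (itinerary (dyckT m) P n)
      ≤ partitionEntropy (muTilde m) (itinerary (dyckT m) Q n) +
          n * partitionEntropy (muTilde m) E :=
        partitionEntropy_itinerary_le_add hQ hE (fun i e => Fin.cases i id e) hrecover
          measurePreserving_dyckT n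
    _ ≤ wordEntropy m (n + 2 * N) + n * ε := by
        gcongr
        · exact partitionEntropy_itinerary_blockList_le q (-N) (2 * N) n
        · exact (hsmall hE hEsmall).le

theorem entropyOfPartition_le {k : ℕ} {P : dyckShift m → Fin k} (hP : Measurable P) :
    entropyOfPartition (muTilde m) (dyckT m) P ≤ ((log 2 + 1 / 2 * log m : ℝ) : EReal) := by
  have hε : ∀ ε > 0, entropyOfPartition (muTilde m) (dyckT m) P ≤
      ((log 2 + 1 / 2 * log m + ε : ℝ) : EReal) := by
    intro ε hε
    obtain ⟨L, hL⟩ := exists_partitionEntropy_itinerary_le hP hε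
    refine entropyOfPartition_le_of_tendsto ((tendsto_wordEntropy_div L).add_const ε) ?_
    filter_upwards [eventually_gt_atTop 0] with n hn
    have : (0 : ℝ) < n := by exact_mod_cast hn
    rw [div_add' _ _ _ this.ne', mul_comm ε]
    gcongr
    exact hL n
  refine ge_of_tendsto (x := nhdsWithin (0 : ℝ) (Set.Ioi 0)) ?_
    (eventually_nhdsWithin_of_forall hε)
  refine (continuous_coe_real_ereal.tendsto _).comp (Tendsto.mono_left ?_ nhdsWithin_le_nhds)
  simpa using (continuous_const_add (log 2 + 1 / 2 * log m)).tendsto 0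

theorem ksEntropy_muTilde :
    ksEntropy (muTilde m) (dyckT m) = ((log 2 + 1 / 2 * log m : ℝ) : EReal) := by
  refine le_antisymm (iSup_le fun k => iSup_le fun P => iSup_le entropyOfPartition_le) ?_
  set e := Fintype.equivFin (DyckLetter m)
  set P : dyckShift m → Fin (Fintype.card (DyckLetter m)) := fun x => e (x.1 0)
  have hP : Measurable P := (measurable_of_finite e).comp
    ((measurable_pi_apply 0).comp measurable_subtype_coe)
  refine le_trans ?_ (le_iSup_of_le _ (le_iSup_of_le P (le_iSup_of_le hP le_rfl)))
  refine le_entropyOfPartition_of_tendsto (tendsto_wordEntropy_div 0) (.of_forall fun n => ?_)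
  rw [← partitionEntropy_wordAt 0]
  gcongr
  refine partitionEntropy_le_of_factorsThrough
    (measurable_itinerary hP measurePreserving_dyckT.measurable n) fun x y hxy => ?_
  funext j
  simpa [P, iterate_dyckT_apply, itinerary, wordAt] using congrFun hxy j

end KolmogorovSinai

/-! ### Topological entropy -/

section TopologicalEntropy

theorem log_card_le_coverEntropy {X κ : Type*} [UniformSpace X] [Fintype κ] {T : X → X} {g : X → κ}
    (hg : {p : X × X | g p.1 = g p.2} ∈ uniformity X)
    (hsurj : ∀ n, Function.Surjective (itinerary T g n)) :
    ENNReal.log (Fintype.card κ) ≤ Dynamics.coverEntropy T Set.univ := by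
  classical
  refine le_trans ?_ (Dynamics.netEntropyEntourage_le_coverEntropy (F := Set.univ) T hg)
  rw [Dynamics.netEntropyEntourage, ← ExpGrowth.expGrowthSup_pow]
  refine ExpGrowth.expGrowthSup_monotone fun n => ?_
  choose f hf using hsurj n
  have hnet : Dynamics.IsDynNetIn T Set.univ {p : X × X | g p.1 = g p.2} n
      ((Finset.univ.image f : Finset X) : Set X) := by
    refine ⟨Set.subset_univ _, ?_⟩
    rw [Finset.coe_image]
    rintro _ ⟨c, -, rfl⟩ _ ⟨c', -, rfl⟩ hne
    refine Set.disjoint_left.2 fun v hv hv' => hne (congrArg f ?_)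
    rw [Dynamics.mem_ball_dynEntourage] at hv hv'
    rw [← hf c, ← hf c']
    exact funext fun k => (hv k k.2).trans (hv' k k.2).symm
  have hcard := hnet.card_le_netMaxcard
  rw [Finset.card_image_of_injective _ (Function.LeftInverse.injective hf), Finset.card_univ,
    Fintype.card_fun, Fintype.card_fin] at hcard
  simpa using ENat.toENNReal_mono hcard

variable {m : ℕ}

theorem leftUnbounded_of_forall_neg {z : ℤ → Bool} (h : ∀ k < 0, z k = true) :
    LeftUnbounded z := by
  have hheight : ∀ k ≤ 0, height z k = k := by
    intro k hk
    have hones : ∑ j ∈ Finset.Ico k 0, (if z j then 1 else -1 : ℤ) = ∑ j ∈ Finset.Ico k 0, 1 :=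
      Finset.sum_congr rfl fun j hj => if_pos (h j (Finset.mem_Ico.1 hj).2)
    rw [height, hones, Finset.Ico_eq_empty (by omega)]
    simp [hk]
  refine leftUnbounded_of_forall fun c => ⟨-(c + 1), by omega, ?_⟩
  rw [hheight _ (by omega)]
  omega

/-- The type of an opening bracket, and `none` for a closing one. -/
def DyckLetter.openingLabel : DyckLetter m → Option (Fin m)
  | α j => some j
  | β _ => none

variable [NeZero m]

/-- The bracket sequence with prescribed opening labels, where `none` asks for a closing bracket;
the types of the closing brackets are then forced. -/
noncomputable def freeSeq (C : ℤ → Option (Fin m)) : ℤ → DyckLetter m :=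
  bracketSeq (fun k => (C k).isSome) fun k => (C k).getD 0

theorem openingLabel_freeSeq (C : ℤ → Option (Fin m)) (k : ℤ) :
    (freeSeq C k).openingLabel = C k := by
  cases h : C k <;> simp [freeSeq, bracketSeq, h, DyckLetter.openingLabel]

theorem surjective_itinerary_openingLabel (n : ℕ) : Function.Surjective
    (itinerary (dyckT m) (fun x => (x.1 0).openingLabel) n) := by
  intro c
  set C : ℤ → Option (Fin m) := Function.extend (fun j : Fin n => (j : ℤ)) c fun _ => some 0
  have hneg : ∀ k < 0, (C k).isSome = true := by
    intro k hk
    have hCk : C k = some 0 := Function.extend_apply' _ _ _ (by rintro ⟨j, rfl⟩; omega)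
    rw [hCk, Option.isSome_some]
  refine ⟨⟨freeSeq C, bracketSeq_mem_dyckShift (leftUnbounded_of_forall_neg hneg) _⟩, ?_⟩
  funext j
  have hinj : Function.Injective fun j : Fin n => (j : ℤ) :=
    Nat.cast_injective.comp Fin.val_injective
  rw [itinerary, iterate_dyckT_apply, openingLabel_freeSeq, zero_add]
  exact hinj.extend_apply _ _ _

theorem log_succ_le_coverEntropy :
    ENNReal.log (m + 1 : ℕ) ≤ Dynamics.coverEntropy (dyckT m) Set.univ := by
  have hcont : UniformContinuous fun x : dyckShift m => x.1 0 :=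
    (Pi.uniformContinuous_proj _ 0).comp uniformContinuous_subtype_val
  have hdiag : SetRel.id ∈ uniformity (DyckLetter m) := by
    rw [show uniformity (DyckLetter m) = Filter.principal SetRel.id from bot_uniformity]
    exact mem_principal_self _
  have hlabel : {p : dyckShift m × dyckShift m |
      (p.1.1 0).openingLabel = (p.2.1 0).openingLabel} ∈ uniformity (dyckShift m) :=
    mem_of_superset (hcont hdiag) fun _ hp => congrArg _ hp
  simpa using log_card_le_coverEntropy hlabel surjective_itinerary_openingLabel

end TopologicalEntropy

theorem log_two_add_half_log_lt {m : ℕ} (hm : 2 ≤ m) :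
    Real.log 2 + 1 / 2 * Real.log m < Real.log (m + 1) := by
  have hm' : (2 : ℝ) ≤ m := by exact_mod_cast hm
  have hlog : Real.log (2 ^ 2 * m) < Real.log ((m + 1) ^ 2) :=
    Real.log_lt_log (by positivity) (by nlinarith)
  rw [Real.log_mul (by norm_num) (by positivity), Real.log_pow, Real.log_pow] at hlog
  push_cast at hlog
  linarith

theorem mainTheorem2 (m : ℕ) (hm : 2 ≤ m) :
    IsProbabilityMeasure (muTilde m) ∧
    MeasurePreserving (dyckT m) (muTilde m) (muTilde m) ∧
    DoubleTailInvariant (muTilde m) ∧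
    ksEntropy (muTilde m) (dyckT m) = ((Real.log 2 + 1 / 2 * Real.log m : ℝ) : EReal) ∧
    ksEntropy (muTilde m) (dyckT m) < Dynamics.coverEntropy (dyckT m) Set.univ ∧
    ¬ IsMaximalEntropyMeasure (muTilde m) (dyckT m) := by
  have : NeZero m := ⟨by omega⟩
  have : Nontrivial (Fin m) := Fin.nontrivial_iff_two_le.2 hm
  have hlt : ksEntropy (muTilde m) (dyckT m) < Dynamics.coverEntropy (dyckT m) Set.univ := by
    refine lt_of_lt_of_le ?_ log_succ_le_coverEntropy
    rw [ksEntropy_muTilde, ENNReal.log_pos_real (by simp) (by simp), EReal.coe_lt_coe_iff,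
      ENNReal.toReal_natCast, Nat.cast_add_one]
    exact log_two_add_half_log_lt hm
  exact ⟨inferInstance, measurePreserving_dyckT, doubleTailInvariant_muTilde, ksEntropy_muTilde,
    hlt, fun hmax => hlt.ne hmax.2.2⟩
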